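/- Let $0<p<1$, $\lambda>0$, $b>0$. Let $A_0,A_1,\dots$ be exponentially distributed with rate $\lambda$ and $Y_0,Y_1,\dots$ be such that $P[Y_n=1]=p$, $P[Y_n=-1]=1-p$, all these variables being independent; let $W_0\geqslant 0$ be an arbitrary random variable and $$W_{n+1}=\max\{0,\,b-A_n+Y_nW_n\},\qquad n\geqslant 0.$$ Put $r_1=\lambda\sqrt{p(2-p)}$, $r_2=-r_1$ and $D=(e^{br_1}-1)\lambda^2(2-p)(1-p)+e^{br_1}r_1\bigl(r_1-\lambda(2-p)\bigr)$, and assume $D\neq 0$. For a real number $\pi_0$ let $$d_1=\frac{\lambda^2(1-p)\bigl(1-p(1-\pi_0)-2\pi_0\bigr)r_1}{D},\qquad d_2=\frac{e^{br_1}\lambda\bigl(1-p(1-\pi_0)-2\pi_0\bigr)r_1(\lambda-r_1)}{D},$$ let $\gamma_0=0$ and, for $i\geqslant 1$, $$\gamma_i=e^{-\lambda ib}(1-p)p^{i-1}\Bigl(\pi_0-1-\frac{d_1-d_2}{r_1}\Bigr)-\sum_{j=1}^2\frac{e^{-\lambda ib}d_j}{r_j}\Bigl(\frac{\lambda p}{\lambda-r_j}\Bigr)^i\Bigl(1-\frac{e^{br_j}(\lambda-r_j)}{\lambda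 p}\Bigr)+i\sum_{j=1}^{i-1}\frac{e^{-\lambda jb}(i-j)^{j-1}(-\lambda pb)^j(\gamma_{i-1-j}-\gamma_{i-j})}{j!}+\gamma_{i-1},$$ and let, for $i\geqslant 0$, $$F_i(x)=1-\frac{p^i}{2-p}+\sum_{j=1}^2\Bigl(\frac{\lambda p}{\lambda-r_j}\Bigr)^i\frac{d_j}{r_j}e^{r_j(x-ib)}+x\sum_{j=0}^{i-1}(-\lambda p)^j\gamma_{i-j}\frac{(x-jb)^{j-1}}{j!}e^{\lambda(x-jb)}.$$ Then $W_n$ converges in distribution to a proper random variable $W$, and its distribution function $F_W$ satisfies, with $\pi_0=P[W=0]$: (i) $F_W(x)=F_i(x)$ for all $x\in[ib,(i+1)b]$, $i=0,1,2,\dots$; (ii) on $(0,b)$, $F_W$ has the derivative $f_W(x)=d_1e^{r_1x}+d_2e^{r_2x}$; (iii) for $x>b$, $F_W$ is differentiable with $f_W(x)=\lambda\bigl(F_W(x)-1+p-p\,F_W(x-b)\bigr)$; (iv) $\pi_0=P[W=0]$ is the unique real number satisfying the normalisation equation $\pi_0+\int_0^\infty f(y)\,dy=1$ with $f$ integrable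 on $(0,\infty)$, where $f$ is the derivative of the function that equals $F_i$ (formed with this $\pi_0$) on $[ib,(i+1)b)$, $i\geqslant 0$. -/

import Mathlib

open MeasureTheory ProbabilityTheory Filter Topology

noncomputable section

namespace LindleyMD

/-- The waiting times: `W_{n+1} = max {0, B_n - A_n + Y_n W_n}`, started from `W₀`. -/
def waitingTime {Ω : Type*} (W₀ : Ω → ℝ) (A B Y : ℕ → Ω → ℝ) : ℕ → Ω → ℝ
  | 0 => W₀
  | n + 1 => fun ω => max 0 (B n ω - A n ω + Y n ω * waitingTime W₀ A B Y n ω)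

/-- The rates `r₁ = lam √(p (2 - p))` (index `0`) and `r₂ = -r₁` (index `1`). -/
def rate (lam p : ℝ) : Fin 2 → ℝ :=
  ![lam * √(p * (2 - p)), -(lam * √(p * (2 - p)))]

/-- The common denominator of the coefficients `d₁` and `d₂`. -/
def denom (lam b p : ℝ) : ℝ :=
  (Real.exp (b * rate lam p 0) - 1) * lam ^ 2 * (2 - p) * (1 - p)
    + Real.exp (b * rate lam p 0) * rate lam p 0 * (rate lam p 0 - lam * (2 - p))

/-- The coefficients `d₁` (index `0`) and `d₂` (index `1`), as functions of the candidate `q`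
for the probability `π₀` of waiting time zero. -/
def coeff (lam b p q : ℝ) : Fin 2 → ℝ :=
  ![lam ^ 2 * (1 - p) * (1 - p * (1 - q) - 2 * q) * rate lam p 0 / denom lam b p,
    Real.exp (b * rate lam p 0) * lam * (1 - p * (1 - q) - 2 * q) * rate lam p 0
      * (lam - rate lam p 0) / denom lam b p]

/-- The constants `γ_i`, given by `γ_0 = 0` and the recursion below with `i = n + 1`. -/
def gammaConst (lam b p q : ℝ) : ℕ → ℝ
  | 0 => 0
  | n + 1 =>
    Real.exp (-lam * ((n + 1 : ℕ) : ℝ) * b) * (1 - p) * p ^ n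
        * (q - 1 - (coeff lam b p q 0 - coeff lam b p q 1) / rate lam p 0)
      - ∑ j : Fin 2, Real.exp (-lam * ((n + 1 : ℕ) : ℝ) * b) * coeff lam b p q j / rate lam p j
          * (lam * p / (lam - rate lam p j)) ^ (n + 1)
          * (1 - Real.exp (b * rate lam p j) * (lam - rate lam p j) / (lam * p))
      + ((n + 1 : ℕ) : ℝ) * ∑ j ∈ (Finset.Icc 1 n).attach,
          Real.exp (-lam * (j.1 : ℝ) * b) * (((n + 1 : ℕ) : ℝ) - (j.1 : ℝ)) ^ (j.1 - 1)
            * (-lam * p * b) ^ j.1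
            * (gammaConst lam b p q (n - j.1) - gammaConst lam b p q (n + 1 - j.1))
            / (Nat.factorial j.1 : ℝ)
      + gammaConst lam b p q n
  termination_by n => n
  decreasing_by
    all_goals first
      | (have hj := Finset.mem_Icc.1 j.2; omega)
      | omega

/-- The recursion for `γ_i`, `i ≥ 1`, written with the index `i`. -/
theorem gammaConst_rec (lam b p q : ℝ) (i : ℕ) (hi : 1 ≤ i) :
    gammaConst lam b p q i =
      Real.exp (-lam * (i : ℝ) * b) * (1 - p) * p ^ (i - 1)
        * (q - 1 - (coeff lam b p q 0 - coeff lam b p q 1) / rate lam p 0)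
      - ∑ j : Fin 2, Real.exp (-lam * (i : ℝ) * b) * coeff lam b p q j / rate lam p j
          * (lam * p / (lam - rate lam p j)) ^ i
          * (1 - Real.exp (b * rate lam p j) * (lam - rate lam p j) / (lam * p))
      + (i : ℝ) * ∑ j ∈ Finset.Icc 1 (i - 1),
          Real.exp (-lam * (j : ℝ) * b) * ((i : ℝ) - (j : ℝ)) ^ (j - 1) * (-lam * p * b) ^ j
            * (gammaConst lam b p q (i - 1 - j) - gammaConst lam b p q (i - j))
            / (Nat.factorial j : ℝ)
      + gammaConst lam b p q (i - 1) := by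
  obtain ⟨n, rfl⟩ : ∃ n, i = n + 1 := ⟨i - 1, by omega⟩
  rw [gammaConst]
  simp only [Nat.add_sub_cancel]
  rw [← Finset.sum_attach (Finset.Icc 1 n)]

/-- The function `F_i`, which gives the waiting-time distribution on `[i b, (i + 1) b]` when
`q = π₀`. The exponent `j - 1` is an integer (it is `-1` for `j = 0`). -/
def pieceCdf (lam b p q : ℝ) (i : ℕ) (x : ℝ) : ℝ :=
  1 - p ^ i / (2 - p)
    + ∑ j : Fin 2, (lam * p / (lam - rate lam p j)) ^ i * (coeff lam b p q j / rate lam p j)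
        * Real.exp (rate lam p j * (x - i * b))
    + x * ∑ j ∈ Finset.range i, (-lam * p) ^ j * gammaConst lam b p q (i - j)
        * ((x - j * b) ^ ((j : ℤ) - 1) / (Nat.factorial j : ℝ))
        * Real.exp (lam * (x - j * b))

/-- The function on `[0, ∞)` that equals `F_i` on `[i b, (i + 1) b)`, for every `i`. -/
def gluedCdf (lam b p q : ℝ) (x : ℝ) : ℝ :=
  pieceCdf lam b p q ⌊x / b⌋₊ x

/-- The normalisation equation `q + ∫_0^∞ f(y) dy = 1`, where the density `f` is the derivative
of the function glued from the `F_i`. -/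
def IsNormalised (lam b p q : ℝ) : Prop :=
  IntegrableOn (deriv (gluedCdf lam b p q)) (Set.Ioi 0) volume ∧
    q + ∫ y in Set.Ioi (0 : ℝ), deriv (gluedCdf lam b p q) y = 1

end LindleyMD

end

noncomputable section

namespace LindleyMD

/-! ### Elementary facts on the constants -/

/-! Existence of the limit is a regeneration argument. The event `A > b`, `Y = -1` has positive
probability and sends every waiting time to `0`. Decomposing by the time since the last such reset
gives an explicit stationary law (`stationary`) and setwise convergence from the start `0`
(`tendsto_iterate_push`); two chains driven by the same pairs agree after a reset, so `W₀` is
irrelevant in the limit.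

Stationarity writes the limit distribution function as an integral of exponential tails.
Differentiating under the integral turns this into a delay equation (`isSolution_cdf`): on `(0, b)`
the derivative involves the value at the reflected point `b - x`, beyond `b` the value at `x - b`.

The glued `F_i` solve the same equation with value `q` at `0` (`isSolution_gluedCdf`): Abel
polynomials times exponentials absorb the delay, and the `γ_i` are what makes consecutive pieces
agree. Two solutions with the same value at `0` coincide (`IsSolution.eq_zero`): on `[0, b]` the
reflected equation is a two-dimensional linear system whose boundary condition is nondegenerate
exactly when `D ≠ 0`; beyond `b` one integrates interval by interval. Hence the limit is the glued
function with `q = π₀`.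

For the normalisation equation, an integrable derivative makes the glued function bounded, and a
bounded homogeneous solution vanishes, because its sup norm contracts by the factor `max p (1 - p) <
1` (`IsSolution.eq_zero_of_bounded`). -/

theorem rate_one (lam p : ℝ) : rate lam p 1 = -rate lam p 0 := by simp [rate]

theorem rate_zero_sq (lam p : ℝ) (hp0 : 0 < p) (hp1 : p < 1) :
    rate lam p 0 ^ 2 = lam ^ 2 * (p * (2 - p)) := by
  have h : 0 ≤ p * (2 - p) := by nlinarith
  simp only [rate, Matrix.cons_val_zero, mul_pow, Real.sq_sqrt h]

theorem rate_zero_pos (lam p : ℝ) (hlam : 0 < lam) (hp0 : 0 < p) (hp1 : p < 1) :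
    0 < rate lam p 0 := by
  have h : 0 < p * (2 - p) := by nlinarith
  simp only [rate, Matrix.cons_val_zero]
  exact mul_pos hlam (Real.sqrt_pos.2 h)

theorem rate_zero_lt (lam p : ℝ) (hlam : 0 < lam) (hp0 : 0 < p) (hp1 : p < 1) :
    rate lam p 0 < lam := by
  have h := rate_zero_sq lam p hp0 hp1
  have : rate lam p 0 ^ 2 < lam ^ 2 := by
    rw [h]; nlinarith [pow_pos hlam 2, mul_pos (pow_pos hlam 2) (pow_pos (sub_pos.2 hp1) 2)]
  exact lt_of_pow_lt_pow_left₀ 2 hlam.le this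

theorem lam_sub_rate_ne (lam p : ℝ) (hlam : 0 < lam) (hp0 : 0 < p) (hp1 : p < 1) (j : Fin 2) :
    lam - rate lam p j ≠ 0 := by
  have h1 := rate_zero_lt lam p hlam hp0 hp1
  have h2 := rate_zero_pos lam p hlam hp0 hp1
  fin_cases j
  · exact (sub_pos.2 h1).ne'
  · change lam - rate lam p 1 ≠ 0
    rw [rate_one]; linarith

theorem rate_ne (lam p : ℝ) (hlam : 0 < lam) (hp0 : 0 < p) (hp1 : p < 1) (j : Fin 2) :
    rate lam p j ≠ 0 := by
  have h2 := rate_zero_pos lam p hlam hp0 hp1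
  fin_cases j
  · exact h2.ne'
  · change rate lam p 1 ≠ 0
    rw [rate_one]; linarith

/-- Inserting `r₁² = lam² p (2 - p)` factors `D`. The last factor is the one that must not vanish
for the boundary value problem on `[0, b]` to be uniquely solvable. -/
theorem denom_eq (lam b p : ℝ) (hp0 : 0 < p) (hp1 : p < 1) :
    denom lam b p = lam * (2 - p) *
      (Real.exp (b * rate lam p 0) * (lam - rate lam p 0) - lam * (1 - p)) := by
  have h := rate_zero_sq lam p hp0 hp1
  unfold denom
  linear_combination Real.exp (b * rate lam p 0) * h

/-- The ratio of the two coefficients. -/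
theorem coeff_one_mul (lam b p q : ℝ) :
    coeff lam b p q 1 * (lam * (1 - p)) =
      coeff lam b p q 0 * (Real.exp (b * rate lam p 0) * (lam - rate lam p 0)) := by
  simp only [coeff, Matrix.cons_val_zero, Matrix.cons_val_one]
  ring

/-- The coefficients are chosen such that `F_0(0)` is the candidate `q`. -/
theorem coeff_zero_sub_one (lam b p q : ℝ) (hlam : 0 < lam) (hp0 : 0 < p) (hp1 : p < 1)
    (hD : denom lam b p ≠ 0) :
    (coeff lam b p q 0 - coeff lam b p q 1) / rate lam p 0 = q - (1 - p) / (2 - p) := by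
  have hr := (rate_zero_pos lam p hlam hp0 hp1).ne'
  have h2 : (2 - p) ≠ 0 := by linarith
  have hDe := denom_eq lam b p hp0 hp1
  simp only [coeff, Matrix.cons_val_zero, Matrix.cons_val_one]
  field_simp
  rw [hDe]
  ring_nf

theorem pieceCdf_zero (lam b p q x : ℝ) :
    pieceCdf lam b p q 0 x = 1 - 1 / (2 - p)
      + ∑ j : Fin 2, coeff lam b p q j / rate lam p j * Real.exp (rate lam p j * x) := by
  simp [pieceCdf]

theorem pieceCdf_zero_zero (lam b p q : ℝ) (hlam : 0 < lam) (hp0 : 0 < p) (hp1 : p < 1)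
    (hD : denom lam b p ≠ 0) : pieceCdf lam b p q 0 0 = q := by
  have h := coeff_zero_sub_one lam b p q hlam hp0 hp1 hD
  have h2 : (2 - p) ≠ 0 := by linarith
  rw [pieceCdf_zero]
  simp only [Fin.sum_univ_two, mul_zero, Real.exp_zero, mul_one, rate_one]
  rw [div_neg, ← sub_eq_add_neg, ← sub_div, h]
  field_simp; ring

theorem hasDerivAt_pieceCdf_zero (lam b p q x : ℝ) (hlam : 0 < lam) (hp0 : 0 < p) (hp1 : p < 1) :
    HasDerivAt (pieceCdf lam b p q 0)
      (∑ j : Fin 2, coeff lam b p q j * Real.exp (rate lam p j * x)) x := by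
  have h : pieceCdf lam b p q 0 = fun x => 1 - 1 / (2 - p)
      + ∑ j : Fin 2, coeff lam b p q j / rate lam p j * Real.exp (rate lam p j * x) := by
    ext x; exact pieceCdf_zero lam b p q x
  rw [h]
  refine HasDerivAt.const_add _ (HasDerivAt.fun_sum fun j _ => ?_)
  have hr := rate_ne lam p hlam hp0 hp1 j
  refine (((hasDerivAt_id' x).const_mul (rate lam p j)).exp.const_mul
    (coeff lam b p q j / rate lam p j)).congr_deriv ?_
  field_simp

/-- The delay equation for `F_0` on `(0, b)`. -/
theorem pieceCdf_zero_ode (lam b p q x : ℝ) (hlam : 0 < lam) (hp0 : 0 < p) (hp1 : p < 1) :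
    ∑ j : Fin 2, coeff lam b p q j * Real.exp (rate lam p j * x) =
      lam * (pieceCdf lam b p q 0 x - (1 - p) + (1 - p) * pieceCdf lam b p q 0 (b - x)) := by
  have hr := rate_zero_pos lam p hlam hp0 hp1
  have hsq := rate_zero_sq lam p hp0 hp1
  have hc := coeff_one_mul lam b p q
  have h2 : (2 - p) ≠ 0 := by linarith
  have h1 : lam * (1 - p) ≠ 0 := mul_ne_zero hlam.ne' (by linarith)
  rw [pieceCdf_zero, pieceCdf_zero]
  simp only [Fin.sum_univ_two, rate_one]
  set r := rate lam p 0 with hrdef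
  set d := coeff lam b p q 0
  have hd : coeff lam b p q 1 = d * (Real.exp (b * r) * (lam - r)) / (lam * (1 - p)) := by
    rw [eq_div_iff h1, hc]
  rw [hd]
  have e1 : Real.exp (r * (b - x)) = Real.exp (b * r) * Real.exp (-r * x) := by
    rw [← Real.exp_add]; ring_nf
  have e2 : Real.exp (-r * (b - x)) = (Real.exp (b * r))⁻¹ * Real.exp (r * x) := by
    rw [← Real.exp_neg, ← Real.exp_add]; ring_nf
  rw [e1, e2]
  have hE : Real.exp (b * r) ≠ 0 := (Real.exp_pos _).ne'
  generalize Real.exp (b * r) = E at *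
  generalize Real.exp (r * x) = X at *
  generalize Real.exp (-r * x) = Y at *
  have h1' : (1 - p) ≠ 0 := by linarith
  field_simp
  linear_combination -(2 - p) * d * E * Y * hsq

/-! ### The Abel polynomials -/

/-- Differentiating an Abel polynomial lowers its degree and shifts its argument by `b`, which is
the shape of a delay term. For `j = 0` the right side reads `(x - b) * (x - b)⁻¹`, which is `1`
except at `x = b`, where the convention `0⁻¹ = 0` makes it `0`. -/
theorem hasDerivAt_abel (b x : ℝ) (j : ℕ) (hx : x ≠ b ∨ j ≠ 0) :
    HasDerivAt (fun x : ℝ => x * ((x - (j + 1 : ℕ) * b) ^ (((j + 1 : ℕ) : ℤ) - 1)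
        / (Nat.factorial (j + 1) : ℝ)))
      ((x - b) * ((x - b - j * b) ^ ((j : ℤ) - 1) / (Nat.factorial j : ℝ))) x := by
  cases j with
  | zero =>
    have hx : x - b ≠ 0 := sub_ne_zero.2 (by simpa using hx)
    simpa [hx] using hasDerivAt_id' x
  | succ k =>
    have e1 : (((k + 1 + 1 : ℕ) : ℤ) - 1) = ((k + 1 : ℕ) : ℤ) := by push_cast; ring
    have e2 : (((k + 1 : ℕ) : ℤ) - 1) = (k : ℤ) := by push_cast; ring
    simp only [e1, e2, zpow_natCast]
    have h := (hasDerivAt_id x).mul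
      ((((hasDerivAt_id x).sub_const (((k + 1 + 1 : ℕ) : ℝ) * b)).pow (k + 1)).div_const
        ((Nat.factorial (k + 1 + 1) : ℕ) : ℝ))
    refine h.congr_deriv ?_
    have hf : (Nat.factorial (k + 1) : ℝ) ≠ 0 := by positivity
    simp only [id, Nat.factorial_succ (k + 1), Pi.pow_apply]
    have e3 : x - b - ((k + 1 : ℕ) : ℝ) * b = x - ((k + 1 + 1 : ℕ) : ℝ) * b := by
      push_cast; ring
    rw [e3]
    simp only [Nat.add_sub_cancel, pow_succ]
    generalize hy : (x - ((k + 1 + 1 : ℕ) : ℝ) * b) ^ k = z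
    push_cast
    have hk : (k : ℝ) + 1 + 1 ≠ 0 := by positivity
    field_simp
    ring

/-- The polynomial part of `F_i`. -/
def abelSum (lam b p q : ℝ) (i : ℕ) (x : ℝ) : ℝ :=
  ∑ j ∈ Finset.range i, (-lam * p) ^ j * gammaConst lam b p q (i - j)
    * (x * ((x - j * b) ^ ((j : ℤ) - 1) / (Nat.factorial j : ℝ))) * Real.exp (lam * (x - j * b))

theorem pieceCdf_eq (lam b p q : ℝ) (i : ℕ) (x : ℝ) :
    pieceCdf lam b p q i x = 1 - p ^ i / (2 - p)
    + ∑ j : Fin 2, (lam * p / (lam - rate lam p j)) ^ i * (coeff lam b p q j / rate lam p j)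
        * Real.exp (rate lam p j * (x - i * b)) + abelSum lam b p q i x := by
  unfold pieceCdf abelSum
  rw [Finset.mul_sum]
  congr 1
  exact Finset.sum_congr rfl fun j _ => by ring

/-- The exponential factors contribute the term `lam` times the sum. The Abel factors contribute the
delayed sum, since the index `i - j` of `γ` is unchanged when `i` and `j` both drop by one. -/
theorem hasDerivAt_abelSum (lam b p q : ℝ) (i : ℕ) (x : ℝ) (hx : x ≠ 0) (hxb : x ≠ b ∨ i = 0) :
    HasDerivAt (abelSum lam b p q (i + 1))
      (lam * abelSum lam b p q (i + 1) x - lam * p * abelSum lam b p q i (x - b)) x := by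
  have hexp : ∀ j : ℕ, HasDerivAt (fun x : ℝ => Real.exp (lam * (x - j * b)))
      (Real.exp (lam * (x - j * b)) * lam) x := fun j => by
    simpa using (((hasDerivAt_id x).sub_const ((j : ℝ) * b)).const_mul lam).exp
  have h0 : HasDerivAt (fun x : ℝ => (-lam * p) ^ 0 * gammaConst lam b p q (i + 1 - 0)
      * (x * ((x - ((0 : ℕ) : ℝ) * b) ^ (((0 : ℕ) : ℤ) - 1) / (Nat.factorial 0 : ℝ)))
        * Real.exp (lam * (x - ((0 : ℕ) : ℝ) * b)))
      (lam * ((-lam * p) ^ 0 * gammaConst lam b p q (i + 1 - 0)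
      * (x * ((x - ((0 : ℕ) : ℝ) * b) ^ (((0 : ℕ) : ℤ) - 1) / (Nat.factorial 0 : ℝ)))
        * Real.exp (lam * (x - ((0 : ℕ) : ℝ) * b)))) x := by
    have h := (hexp 0).const_mul (gammaConst lam b p q (i + 1))
    refine (h.congr_of_eventuallyEq ?_).congr_deriv ?_
    · filter_upwards [isOpen_ne.mem_nhds hx] with y hy
      have hy : y ≠ 0 := hy
      simp [hy]
    · simp [hx]; ring
  have hs : ∀ j ∈ Finset.range i, HasDerivAt (fun x : ℝ => (-lam * p) ^ (j + 1)
      * gammaConst lam b p q (i + 1 - (j + 1))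
      * (x * ((x - ((j + 1 : ℕ) : ℝ) * b) ^ (((j + 1 : ℕ) : ℤ) - 1) / (Nat.factorial (j + 1) : ℝ)))
        * Real.exp (lam * (x - ((j + 1 : ℕ) : ℝ) * b)))
      (lam * ((-lam * p) ^ (j + 1) * gammaConst lam b p q (i + 1 - (j + 1))
      * (x * ((x - ((j + 1 : ℕ) : ℝ) * b) ^ (((j + 1 : ℕ) : ℤ) - 1) / (Nat.factorial (j + 1) : ℝ)))
        * Real.exp (lam * (x - ((j + 1 : ℕ) : ℝ) * b)))
        + -(lam * p) * ((-lam * p) ^ j * gammaConst lam b p q (i - j)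
          * ((x - b) * ((x - b - j * b) ^ ((j : ℤ) - 1) / (Nat.factorial j : ℝ)))
          * Real.exp (lam * (x - b - j * b)))) x := fun j hj => by
    have hi : i ≠ 0 := by rintro rfl; simp at hj
    have h := ((hasDerivAt_abel b x j (Or.inl (hxb.resolve_right hi))).const_mul
      ((-lam * p) ^ (j + 1) * gammaConst lam b p q (i + 1 - (j + 1)))).mul (hexp (j + 1))
    refine h.congr_deriv ?_
    have e : x - b - (j : ℝ) * b = x - ((j + 1 : ℕ) : ℝ) * b := by push_cast; ring
    rw [e, Nat.add_sub_add_right, pow_succ]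
    ring
  have h := (HasDerivAt.fun_sum hs).add h0
  have e : abelSum lam b p q (i + 1) = _ := funext fun y => Finset.sum_range_succ' _ _
  rw [e]
  refine h.congr_deriv ?_
  simp only [abelSum]
  rw [Finset.sum_add_distrib, ← Finset.mul_sum, ← Finset.mul_sum]
  ring

theorem hasDerivAt_pieceCdf (lam b p q : ℝ) (hlam : 0 < lam) (hp0 : 0 < p) (hp1 : p < 1)
    (i : ℕ) (x : ℝ) (hx : x ≠ 0) (hxb : x ≠ b ∨ i = 0) :
    HasDerivAt (pieceCdf lam b p q (i + 1))
      (lam * (pieceCdf lam b p q (i + 1) x - 1 + p - p * pieceCdf lam b p q i (x - b))) x := by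
  have h2 : (2 - p) ≠ 0 := by linarith
  have hexp : ∀ j ∈ (Finset.univ : Finset (Fin 2)), HasDerivAt (fun x : ℝ =>
      (lam * p / (lam - rate lam p j)) ^ (i + 1) * (coeff lam b p q j / rate lam p j)
        * Real.exp (rate lam p j * (x - (i + 1 : ℕ) * b)))
      (lam * ((lam * p / (lam - rate lam p j)) ^ (i + 1) * (coeff lam b p q j / rate lam p j)
        * Real.exp (rate lam p j * (x - (i + 1 : ℕ) * b)))
        + -(lam * p) * ((lam * p / (lam - rate lam p j)) ^ i * (coeff lam b p q j / rate lam p j)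
        * Real.exp (rate lam p j * (x - b - i * b)))) x := fun j _ => by
    have hr := lam_sub_rate_ne lam p hlam hp0 hp1 j
    have h : HasDerivAt (fun x : ℝ => Real.exp (rate lam p j * (x - (i + 1 : ℕ) * b)))
      (Real.exp (rate lam p j * (x - (i + 1 : ℕ) * b)) * rate lam p j) x := by
      simpa using (((hasDerivAt_id x).sub_const (((i + 1 : ℕ) : ℝ) * b)).const_mul
        (rate lam p j)).exp
    refine (h.const_mul _).congr_deriv ?_
    have e : x - b - (i : ℝ) * b = x - ((i + 1 : ℕ) : ℝ) * b := by push_cast; ring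
    rw [e, pow_succ]
    generalize Real.exp _ = X
    generalize (lam * p / (lam - rate lam p j)) ^ i = Z
    generalize coeff lam b p q j / rate lam p j = d
    field_simp
    ring
  have h := ((HasDerivAt.fun_sum hexp).const_add (1 - p ^ (i + 1) / (2 - p))).add
    (hasDerivAt_abelSum lam b p q i x hx hxb)
  have e : pieceCdf lam b p q (i + 1) = _ := funext fun y => pieceCdf_eq lam b p q (i + 1) y
  rw [e]
  refine h.congr_deriv ?_
  beta_reduce
  rw [pieceCdf_eq, Finset.sum_add_distrib, ← Finset.mul_sum, ← Finset.mul_sum]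
  generalize ∑ j : Fin 2, (lam * p / (lam - rate lam p j)) ^ (i + 1) *
    (coeff lam b p q j / rate lam p j) *
      Real.exp (rate lam p j * (x - (i + 1 : ℕ) * b)) = S
  generalize ∑ j : Fin 2, (lam * p / (lam - rate lam p j)) ^ i *
    (coeff lam b p q j / rate lam p j) * Real.exp (rate lam p j * (x - b - i * b)) = T
  field_simp
  ring

/-- Consecutive pieces agree at the breakpoints. -/
theorem pieceCdf_succ_eq (lam b p q : ℝ) (hlam : 0 < lam) (hb : 0 < b) (hp0 : 0 < p)
    (hp1 : p < 1) (hD : denom lam b p ≠ 0) (n : ℕ) :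
    pieceCdf lam b p q (n + 1) ((n + 1 : ℕ) * b) = pieceCdf lam b p q n ((n + 1 : ℕ) * b) := by
  have h2 : (2 - p) ≠ 0 := by linarith
  have hrec := gammaConst_rec lam b p q (n + 1) (by omega)
  have hq := coeff_zero_sub_one lam b p q hlam hp0 hp1 hD
  set y : ℝ := ((n + 1 : ℕ) : ℝ) * b with hy
  have hy0 : y ≠ 0 := by positivity
  -- The extra term `j = n` vanishes because `γ_0 = 0`; both sums now have the same range and can be
  -- subtracted termwise.
  have hn : abelSum lam b p q n y = ∑ j ∈ Finset.range (n + 1), (-lam * p) ^ j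
      * gammaConst lam b p q (n - j)
      * (y * ((y - j * b) ^ ((j : ℤ) - 1) / (Nat.factorial j : ℝ)))
        * Real.exp (lam * (y - j * b)) := by
    rw [Finset.sum_range_succ, abelSum]
    simp [gammaConst]
  have hdiff : abelSum lam b p q (n + 1) y - abelSum lam b p q n y = Real.exp (lam * y) *
      (gammaConst lam b p q (n + 1) - gammaConst lam b p q n
      - ((n + 1 : ℕ) : ℝ) * ∑ j ∈ Finset.Icc 1 (n + 1 - 1),
          Real.exp (-lam * (j : ℝ) * b) * (((n + 1 : ℕ) : ℝ) - (j : ℝ)) ^ (j - 1)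
            * (-lam * p * b) ^ j
            * (gammaConst lam b p q (n + 1 - 1 - j) - gammaConst lam b p q (n + 1 - j))
            / (Nat.factorial j : ℝ)) := by
    rw [hn, abelSum, ← Finset.sum_sub_distrib, Finset.sum_range_succ', Nat.add_sub_cancel,
      ← Finset.Ico_add_one_right_eq_Icc, Finset.sum_Ico_eq_sum_range, Finset.mul_sum,
      Nat.add_sub_cancel, sub_eq_neg_add _ (∑ i ∈ _, _), mul_add, ← Finset.sum_neg_distrib,
      Finset.mul_sum]
    congr 1
    · refine Finset.sum_congr rfl fun j _ => ?_
      rw [add_comm 1 j]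
      have e1 : (((j + 1 : ℕ) : ℤ) - 1) = (j : ℤ) := by push_cast; ring
      have e2 : y - ((j + 1 : ℕ) : ℝ) * b = (((n + 1 : ℕ) : ℝ) - ((j + 1 : ℕ) : ℝ)) * b := by
        rw [hy]; ring
      have e3 : Real.exp (lam * (y - ((j + 1 : ℕ) : ℝ) * b))
          = Real.exp (lam * y) * Real.exp (-lam * ((j + 1 : ℕ) : ℝ) * b) := by
        rw [← Real.exp_add]; ring_nf
      rw [e3, e2, e1, zpow_natCast, Nat.add_sub_cancel, Nat.add_sub_add_right]
      generalize ((n + 1 : ℕ) : ℝ) - ((j + 1 : ℕ) : ℝ) = z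
      generalize Real.exp (lam * y) = X
      rw [hy]
      ring
    · simp [hy0]
      ring
  rw [pieceCdf_eq, pieceCdf_eq]
  -- The convolution sum and `γ_n` cancel against the recursion for `γ_{n+1}`; what remains is the
  -- jump of the exponential part of the pieces, up to sign.
  have key : abelSum lam b p q (n + 1) y - abelSum lam b p q n y = Real.exp (lam * y) *
      (Real.exp (-lam * ((n + 1 : ℕ) : ℝ) * b) * (1 - p) * p ^ n
        * (q - 1 - (coeff lam b p q 0 - coeff lam b p q 1) / rate lam p 0)
      - ∑ j : Fin 2, Real.exp (-lam * ((n + 1 : ℕ) : ℝ) * b) * coeff lam b p q j / rate lam p j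
          * (lam * p / (lam - rate lam p j)) ^ (n + 1)
          * (1 - Real.exp (b * rate lam p j) * (lam - rate lam p j) / (lam * p))) := by
    rw [hdiff, hrec]
    simp only [Nat.add_sub_cancel]
    ring
  have e4 : Real.exp (-lam * ((n + 1 : ℕ) : ℝ) * b) = (Real.exp (lam * y))⁻¹ := by
    rw [← Real.exp_neg, hy]; ring_nf
  rw [e4, hq] at key
  have hE := (Real.exp_pos (lam * y)).ne'
  have e5 : y - ((n + 1 : ℕ) : ℝ) * b = 0 := by rw [hy]; ring
  have e6 : y - (n : ℝ) * b = b := by rw [hy]; push_cast; ring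
  have hn0 := rate_ne lam p hlam hp0 hp1 0
  have hn1 := rate_ne lam p hlam hp0 hp1 1
  have hr0 := lam_sub_rate_ne lam p hlam hp0 hp1 0
  have hr1 := lam_sub_rate_ne lam p hlam hp0 hp1 1
  rw [e5, e6]
  simp only [Fin.sum_univ_two] at key ⊢
  refine sub_eq_zero.1 (Eq.trans ?_ (sub_eq_zero.2 key))
  simp only [mul_comm _ b, mul_zero, Real.exp_zero]
  have k0 : (lam * p / (lam - rate lam p 0)) ^ n
      = (lam * p / (lam - rate lam p 0)) ^ (n + 1) * ((lam - rate lam p 0) / (lam * p)) := by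
    rw [pow_succ]; field_simp
  have k1 : (lam * p / (lam - rate lam p 1)) ^ n
      = (lam * p / (lam - rate lam p 1)) ^ (n + 1) * ((lam - rate lam p 1) / (lam * p)) := by
    rw [pow_succ]; field_simp
  rw [k0, k1]
  generalize (lam * p / (lam - rate lam p 0)) ^ (n + 1) = Z0
  generalize (lam * p / (lam - rate lam p 1)) ^ (n + 1) = Z1
  generalize Real.exp (b * rate lam p 0) = X0
  generalize Real.exp (b * rate lam p 1) = X1
  field_simp
  ring

/-! ### The delay differential equation -/

/-- Continuous solutions on `[0, ∞)` of the delay differential equation for the waiting-time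
distribution, with inhomogeneity scaled by `c`. -/
structure IsSolution (lam b p c : ℝ) (F : ℝ → ℝ) : Prop where
  continuousOn : ContinuousOn F (Set.Ici 0)
  hasDerivAt_first : ∀ x ∈ Set.Ioo 0 b,
    HasDerivAt F (lam * (F x - c * (1 - p) + (1 - p) * F (b - x))) x
  hasDerivAt_succ : ∀ n : ℕ, ∀ x ∈ Set.Ioo (((n + 1 : ℕ) : ℝ) * b) (((n + 1 : ℕ) + 1 : ℝ) * b),
    HasDerivAt F (lam * (F x - c * (1 - p) - p * F (x - b))) x

theorem IsSolution.sub {lam b p : ℝ} {F G : ℝ → ℝ} (hF : IsSolution lam b p 1 F)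
    (hG : IsSolution lam b p 1 G) : IsSolution lam b p 0 (F - G) where
  continuousOn := hF.continuousOn.sub hG.continuousOn
  hasDerivAt_first x hx := ((hF.hasDerivAt_first x hx).sub (hG.hasDerivAt_first x hx)).congr_deriv
    (by simp only [Pi.sub_apply]; ring)
  hasDerivAt_succ n x hx := ((hF.hasDerivAt_succ n x hx).sub
    (hG.hasDerivAt_succ n x hx)).congr_deriv (by simp only [Pi.sub_apply]; ring)

/-- The integrating factor `exp (-k (x - a))` makes a function with zero derivative inside. Only
continuity is asked at the endpoints, where solutions may have kinks. -/
theorem eq_mul_exp_of_hasDerivAt {f : ℝ → ℝ} {a c k : ℝ} (hf : ContinuousOn f (Set.Icc a c))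
    (hd : ∀ x ∈ Set.Ioo a c, HasDerivAt f (k * f x) x) {x : ℝ} (hx : x ∈ Set.Icc a c) :
    f x = f a * Real.exp (k * (x - a)) := by
  have hexp : ∀ y, HasDerivAt (fun y => Real.exp (-k * (y - a)))
      (Real.exp (-k * (y - a)) * -k) y := fun y => by
    simpa using (((hasDerivAt_id y).sub_const a).const_mul (-k)).exp
  have hder : ∀ y ∈ interior (Set.Icc a c),
      HasDerivAt (fun y => f y * Real.exp (-k * (y - a))) 0 y := fun y hy => by
      rw [interior_Icc] at hy
      exact ((hd y hy).mul (hexp y)).congr_deriv (by ring)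
  have hcont : ContinuousOn (fun y => f y * Real.exp (-k * (y - a))) (Set.Icc a c) :=
    hf.mul (by fun_prop)
  have ha : a ∈ Set.Icc a c := ⟨le_rfl, hx.1.trans hx.2⟩
  have h1 := monotoneOn_of_hasDerivWithinAt_nonneg (convex_Icc a c) hcont
    (fun y hy => (hder y hy).hasDerivWithinAt) (fun _ _ => le_rfl) ha hx hx.1
  have h2 := antitoneOn_of_hasDerivWithinAt_nonpos (convex_Icc a c) hcont
    (fun y hy => (hder y hy).hasDerivWithinAt) (fun _ _ => le_rfl) ha hx hx.1
  have h := le_antisymm h1 h2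
  simp only [sub_self, mul_zero, Real.exp_zero, mul_one] at h
  rw [h, mul_assoc, ← Real.exp_add]
  simp

/-- A homogeneous solution that vanishes at `0` vanishes on `[0, b]`. -/
theorem IsSolution.eq_zero_on_Icc {lam b p : ℝ} (hlam : 0 < lam) (hb : 0 < b) (hp0 : 0 < p)
    (hp1 : p < 1) (hD : denom lam b p ≠ 0) {V : ℝ → ℝ} (hV : IsSolution lam b p 0 V)
    (h0 : V 0 = 0) {x : ℝ} (hx : x ∈ Set.Icc 0 b) : V x = 0 := by
  have h1p : 1 - p ≠ 0 := by linarith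
  have hr0 := rate_zero_pos lam p hlam hp0 hp1
  have hsq := rate_zero_sq lam p hp0 hp1
  have hlt := rate_zero_lt lam p hlam hp0 hp1
  have hDe := denom_eq lam b p hp0 hp1
  set r := rate lam p 0
  -- The pair `(V x, V (b - x))` obeys a linear system with constant coefficients; `(1, k)` is a
  -- left eigenvector with eigenvalue `r`, so `V x + k V (b - x)` is a multiple of `exp (r x)`.
  set k : ℝ := (lam - r) / (lam * (1 - p)) with hk
  have hk1 : lam * (1 - k * (1 - p)) = r := by rw [hk]; field_simp; ring
  have hk2 : lam * ((1 - p) - k) = r * k := by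
    rw [hk]; field_simp; linear_combination hsq
  have hcV : ContinuousOn V (Set.Icc 0 b) := hV.continuousOn.mono Set.Icc_subset_Ici_self
  have hu : ∀ x ∈ Set.Icc 0 b,
      V x + k * V (b - x) = (V 0 + k * V (b - 0)) * Real.exp (r * (x - 0)) := by
    intro x hx
    refine eq_mul_exp_of_hasDerivAt (f := fun x => V x + k * V (b - x)) (c := b) ?_ ?_ hx
    · refine hcV.add (ContinuousOn.mul continuousOn_const (hcV.comp (by fun_prop) ?_))
      intro y hy
      exact ⟨by linarith [hy.2], by linarith [hy.1]⟩
    · intro y hy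
      have d1 := hV.hasDerivAt_first y hy
      have d2 := (hV.hasDerivAt_first (b - y) ⟨by linarith [hy.2], by linarith [hy.1]⟩).comp y
        ((hasDerivAt_id y).const_sub b)
      refine (d1.add (d2.const_mul k)).congr_deriv ?_
      rw [sub_sub_cancel]
      linear_combination V y * hk1 + V (b - y) * hk2
  -- With `V 0 = 0`, comparing both ends gives `V b = k V b exp (r b)`; the factor left after
  -- collecting terms is a nonzero multiple of `D`.
  have hbb := hu b ⟨hb.le, le_rfl⟩
  simp only [sub_self, h0, sub_zero, mul_zero, add_zero, zero_add] at hbb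
  have hVb : V b = 0 := by
    have : V b * (Real.exp (b * r) * (lam - r) - lam * (1 - p)) = 0 := by
      have hkm : k * (lam * (1 - p)) = lam - r := by rw [hk]; field_simp
      rw [← hkm, mul_comm b r]
      linear_combination -(lam * (1 - p)) * hbb
    refine (mul_eq_zero.1 this).resolve_right fun h => hD ?_
    rw [hDe, h, mul_zero]
  have hz : ∀ x ∈ Set.Icc 0 b, V x = -k * V (b - x) := by
    intro x hx
    have h := hu x hx
    simp only [h0, sub_zero, hVb, mul_zero, add_zero, zero_mul] at h
    linarith
  have e1 := hz x hx
  have e2 := hz (b - x) ⟨by linarith [hx.2], by linarith [hx.1]⟩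
  rw [sub_sub_cancel] at e2
  have hk0 : 0 < k := div_pos (by linarith) (mul_pos hlam (by linarith))
  -- Applying the reflection twice. The case `k = 1` would force both `r = lam p` and `r = -lam p`.
  have e3 : (1 - k ^ 2) * V x = 0 := by rw [e2] at e1; linear_combination e1
  refine (mul_eq_zero.1 e3).resolve_left fun h => ?_
  have hk' : k = 1 := by nlinarith
  rw [hk'] at hk1 hk2
  linarith

theorem exists_mem_Icc_mul {b x : ℝ} (hb : 0 < b) (hx : 0 ≤ x) :
    ∃ n : ℕ, x ∈ Set.Ico ((n : ℝ) * b) ((n + 1 : ℝ) * b) :=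
  ⟨⌊x / b⌋₊, (le_div_iff₀ hb).1 (Nat.floor_le (by positivity)),
    (div_lt_iff₀ hb).1 (Nat.lt_floor_add_one _)⟩

/-- A homogeneous solution that vanishes at `0` vanishes on `[0, ∞)`. -/
theorem IsSolution.eq_zero {lam b p : ℝ} (hlam : 0 < lam) (hb : 0 < b) (hp0 : 0 < p)
    (hp1 : p < 1) (hD : denom lam b p ≠ 0) {V : ℝ → ℝ} (hV : IsSolution lam b p 0 V)
    (h0 : V 0 = 0) {x : ℝ} (hx : 0 ≤ x) : V x = 0 := by
  have key : ∀ n : ℕ, ∀ x ∈ Set.Icc ((n : ℝ) * b) ((n + 1 : ℝ) * b), V x = 0 := by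
    intro n
    induction n with
    | zero =>
      intro x hx
      exact hV.eq_zero_on_Icc hlam hb hp0 hp1 hD h0 (by simpa using hx)
    | succ n ih =>
      intro x hx
      have hn : (0 : ℝ) ≤ ((n + 1 : ℕ) : ℝ) * b := by positivity
      have h := eq_mul_exp_of_hasDerivAt (f := V) (k := lam)
        (hV.continuousOn.mono fun y hy => hn.trans hy.1) (fun y hy => by
          refine (hV.hasDerivAt_succ n y hy).congr_deriv ?_
          rw [ih (y - b) ⟨by have := hy.1; push_cast at this; linarith,
            by have := hy.2; push_cast at this; linarith⟩]
          ring) hx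
      rw [h, ih _ ⟨by push_cast; linarith, by push_cast; linarith⟩, zero_mul]
  obtain ⟨n, hn⟩ := exists_mem_Icc_mul hb hx
  exact key n x ⟨hn.1, hn.2.le⟩

theorem IsSolution.neg {lam b p : ℝ} {V : ℝ → ℝ} (hV : IsSolution lam b p 0 V) :
    IsSolution lam b p 0 (-V) where
  continuousOn := hV.continuousOn.neg
  hasDerivAt_first x hx := (hV.hasDerivAt_first x hx).neg.congr_deriv
    (by simp only [Pi.neg_apply]; ring)
  hasDerivAt_succ n x hx := (hV.hasDerivAt_succ n x hx).neg.congr_deriv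
    (by simp only [Pi.neg_apply]; ring)

/-- A bound on a homogeneous solution improves itself. -/
theorem IsSolution.neg_mul_le {lam b p : ℝ} (hlam : 0 < lam) (hb : 0 < b) (hp0 : 0 < p)
    (hp1 : p < 1) {V : ℝ → ℝ} (hV : IsSolution lam b p 0 V) {M : ℝ}
    (hM : ∀ x, 0 ≤ x → |V x| ≤ M) {x : ℝ} (hx : 0 ≤ x) : -(max p (1 - p) * M) ≤ V x := by
  set θ := max p (1 - p)
  have hM0 : 0 ≤ M := (abs_nonneg _).trans (hM 0 le_rfl)
  -- Since `V' = lam (V + z)` with a delayed or reflected term `|z| ≤ θ M`, this `g` is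
  -- nonincreasing. Boundedness of `V` sends `g` to `0` along the multiples of `b`, so `g` is
  -- nonnegative.
  set g : ℝ → ℝ := fun y => Real.exp (-lam * y) * (V y + θ * M) with hg
  have hexp : ∀ y, HasDerivAt (fun y => Real.exp (-lam * y)) (Real.exp (-lam * y) * -lam) y :=
    fun y => by simpa using ((hasDerivAt_id y).const_mul (-lam)).exp
  have hcont : ContinuousOn g (Set.Ici 0) :=
    ContinuousOn.mul (by fun_prop) (hV.continuousOn.add continuousOn_const)
  have hanti : ∀ n : ℕ, AntitoneOn g (Set.Icc ((n : ℝ) * b) ((n + 1 : ℝ) * b)) := by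
    intro n
    have hd : ∀ y ∈ Set.Ioo ((n : ℝ) * b) ((n + 1 : ℝ) * b), ∃ z, |z| ≤ θ * M ∧
        HasDerivAt V (lam * (V y + z)) y := by
      intro y hy
      cases n with
      | zero =>
        have hy' : y ∈ Set.Ioo 0 b := by simpa using hy
        refine ⟨(1 - p) * V (b - y), ?_, (hV.hasDerivAt_first y hy').congr_deriv (by ring)⟩
        rw [abs_mul, abs_of_pos (sub_pos.2 hp1)]
        exact mul_le_mul (le_max_right _ _) (hM _ (by linarith [hy'.2])) (abs_nonneg _)
          (hp0.le.trans (le_max_left _ _))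
      | succ n =>
        refine ⟨-(p * V (y - b)), ?_, (hV.hasDerivAt_succ n y hy).congr_deriv (by ring)⟩
        rw [abs_neg, abs_mul, abs_of_pos hp0]
        refine mul_le_mul (le_max_left _ _) (hM _ ?_) (abs_nonneg _)
          (hp0.le.trans (le_max_left _ _))
        have h1 := hy.1
        have : (0 : ℝ) ≤ (n : ℝ) * b := by positivity
        push_cast at h1
        linarith
    choose! z hz hzd using hd
    refine antitoneOn_of_hasDerivWithinAt_nonpos (convex_Icc _ _)
      (f' := fun y => Real.exp (-lam * y) * -lam * (V y + θ * M)
        + Real.exp (-lam * y) * (lam * (V y + z y)))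
      (hcont.mono fun y hy => le_trans (by positivity) hy.1) (fun y hy => ?_) fun y hy => ?_
    · rw [interior_Icc] at hy
      exact ((hexp y).mul ((hzd y hy).add_const (θ * M))).hasDerivWithinAt
    · rw [interior_Icc] at hy
      have h1 := (abs_le.1 (hz y hy)).2
      have h2 := mul_nonneg (mul_pos (Real.exp_pos (-lam * y)) hlam).le (sub_nonneg.2 h1)
      linarith
  have hseq : Antitone fun n : ℕ => g ((n : ℝ) * b) := antitone_nat_of_succ_le fun n => by
    have h1 : (n : ℝ) * b ≤ (n + 1 : ℝ) * b := by linarith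
    have := hanti n ⟨le_rfl, h1⟩ ⟨h1, le_rfl⟩ h1
    simpa using this
  have hlim : Tendsto (fun n : ℕ => g ((n : ℝ) * b)) atTop (𝓝 0) := by
    have he : Tendsto (fun n : ℕ => Real.exp (-lam * ((n : ℝ) * b)) * (M + θ * M)) atTop (𝓝 0) := by
      rw [← zero_mul (M + θ * M)]
      refine Tendsto.mul_const _ (Real.tendsto_exp_atBot.comp ?_)
      exact (tendsto_natCast_atTop_atTop.atTop_mul_const hb).const_mul_atTop_of_neg (by linarith)
    refine squeeze_zero_norm (fun n => ?_) he
    rw [hg, Real.norm_eq_abs, abs_mul, abs_of_pos (Real.exp_pos _)]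
    refine mul_le_mul_of_nonneg_left ((abs_add_le _ _).trans ?_) (Real.exp_pos _).le
    have hθ : 0 ≤ θ * M := mul_nonneg (hp0.le.trans (le_max_left _ _)) hM0
    rw [abs_of_nonneg hθ]
    exact add_le_add_left (hM _ (by positivity)) _
  have hg0 : 0 ≤ g x := by
    obtain ⟨n, hn⟩ := exists_mem_Icc_mul hb hx
    have h1 := hanti n ⟨hn.1, hn.2.le⟩ ⟨by linarith, le_rfl⟩ hn.2.le
    have h2 := hseq.le_of_tendsto hlim (n + 1)
    push_cast at h2
    exact h2.trans h1
  have := nonneg_of_mul_nonneg_right hg0 (Real.exp_pos _)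
  linarith

/-- Bounded homogeneous solutions vanish. -/
theorem IsSolution.eq_zero_of_bounded {lam b p : ℝ} (hlam : 0 < lam) (hb : 0 < b) (hp0 : 0 < p)
    (hp1 : p < 1) {V : ℝ → ℝ} (hV : IsSolution lam b p 0 V) {M : ℝ}
    (hM : ∀ x, 0 ≤ x → |V x| ≤ M) {x : ℝ} (hx : 0 ≤ x) : V x = 0 := by
  have hM0 : 0 ≤ M := (abs_nonneg _).trans (hM 0 le_rfl)
  set θ := max p (1 - p)
  have hθ0 : 0 ≤ θ := hp0.le.trans (le_max_left _ _)
  have hθ1 : θ < 1 := max_lt hp1 (by linarith)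
  have hiter : ∀ n : ℕ, ∀ y, 0 ≤ y → |V y| ≤ θ ^ n * M := by
    intro n
    induction n with
    | zero => simpa using hM
    | succ n ih =>
      intro y hy
      have h1 := hV.neg_mul_le hlam hb hp0 hp1 ih hy
      have h2 := hV.neg.neg_mul_le hlam hb hp0 hp1 (M := θ ^ n * M) (by simpa using ih) hy
      rw [pow_succ', mul_assoc, abs_le]
      exact ⟨h1, by simpa using h2⟩
  have hlim : Tendsto (fun n : ℕ => θ ^ n * M) atTop (𝓝 0) := by
    simpa using (tendsto_pow_atTop_nhds_zero_of_lt_one hθ0 hθ1).mul_const M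
  exact abs_nonpos_iff.1 (ge_of_tendsto' hlim fun n => hiter n x hx)

/-! ### The glued function -/

theorem gluedCdf_eq_of_mem_Ico {lam b p q : ℝ} (hb : 0 < b) {n : ℕ} {x : ℝ}
    (hx : x ∈ Set.Ico ((n : ℝ) * b) ((n + 1 : ℝ) * b)) :
    gluedCdf lam b p q x = pieceCdf lam b p q n x := by
  have : ⌊x / b⌋₊ = n := by
    rw [Nat.floor_eq_iff (div_nonneg (le_trans (by positivity) hx.1) hb.le)]
    exact ⟨(le_div_iff₀ hb).2 hx.1, (div_lt_iff₀ hb).2 hx.2⟩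
  rw [gluedCdf, this]

theorem gluedCdf_eq {lam b p q : ℝ} (hlam : 0 < lam) (hb : 0 < b) (hp0 : 0 < p)
    (hp1 : p < 1) (hD : denom lam b p ≠ 0) {n : ℕ} {x : ℝ}
    (hx : x ∈ Set.Icc ((n : ℝ) * b) ((n + 1 : ℝ) * b)) :
    gluedCdf lam b p q x = pieceCdf lam b p q n x := by
  rcases hx.2.lt_or_eq with h | h
  · exact gluedCdf_eq_of_mem_Ico hb ⟨hx.1, h⟩
  · have h1 := pieceCdf_succ_eq lam b p q hlam hb hp0 hp1 hD n
    have h2 : gluedCdf lam b p q x = pieceCdf lam b p q (n + 1) x := by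
      refine gluedCdf_eq_of_mem_Ico hb ⟨?_, ?_⟩ <;> rw [h] <;> push_cast <;> linarith
    push_cast at h1
    rw [h2, h, h1]

theorem gluedCdf_zero {lam b p : ℝ} (q : ℝ) (hlam : 0 < lam) (hb : 0 < b) (hp0 : 0 < p)
    (hp1 : p < 1) (hD : denom lam b p ≠ 0) : gluedCdf lam b p q 0 = q := by
  rw [gluedCdf_eq_of_mem_Ico (n := 0) hb (by simpa using hb)]
  exact pieceCdf_zero_zero lam b p q hlam hp0 hp1 hD

theorem continuousOn_pieceCdf {lam b p : ℝ} (q : ℝ) (hlam : 0 < lam) (hb : 0 < b) (hp0 : 0 < p)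
    (hp1 : p < 1) (n : ℕ) :
    ContinuousOn (pieceCdf lam b p q n) (Set.Icc ((n : ℝ) * b) ((n + 1 : ℝ) * b)) := by
  intro x hx
  cases n with
  | zero =>
    exact (hasDerivAt_pieceCdf_zero lam b p q x hlam hp0 hp1).continuousAt.continuousWithinAt
  | succ n =>
    have h1 := hx.1
    push_cast at h1
    have hn : (0 : ℝ) ≤ (n : ℝ) * b := by positivity
    refine (hasDerivAt_pieceCdf lam b p q hlam hp0 hp1 n x (by linarith)
      ?_).continuousAt.continuousWithinAt
    rcases eq_or_ne n 0 with h0 | h0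
    · exact Or.inr h0
    · have : (1 : ℝ) ≤ n := by exact_mod_cast Nat.one_le_iff_ne_zero.2 h0
      exact Or.inl (by nlinarith)

/-- Continuity on `[0, ∞)` from continuity on the intervals `[n b, (n + 1) b]`. -/
theorem continuousOn_Ici_of_Icc {b : ℝ} (hb : 0 < b) {f : ℝ → ℝ}
    (h : ∀ n : ℕ, ContinuousOn f (Set.Icc ((n : ℝ) * b) ((n + 1 : ℝ) * b))) :
    ContinuousOn f (Set.Ici 0) := by
  have key : ∀ n : ℕ, ContinuousOn f (Set.Icc 0 ((n : ℝ) * b)) := by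
    intro n
    induction n with
    | zero => simp
    | succ n ih =>
      have hn : (0 : ℝ) ≤ (n : ℝ) * b := by positivity
      have := ih.union_of_isClosed (h n) isClosed_Icc isClosed_Icc
      rwa [Set.Icc_union_Icc_eq_Icc hn (by linarith), ← Nat.cast_add_one] at this
  intro x hx
  obtain ⟨n, hn⟩ := exists_mem_Icc_mul hb hx
  refine ((key (n + 1)) x ⟨hx, by push_cast; exact hn.2.le⟩).mono_of_mem_nhdsWithin ?_
  rw [← Set.Ici_inter_Iic]
  exact inter_mem_nhdsWithin _ (Iic_mem_nhds (by push_cast; exact hn.2))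

/-- Holds for every real `q`, so the solutions form a one-parameter family indexed by the value at
`0`. -/
theorem isSolution_gluedCdf {lam b p : ℝ} (q : ℝ) (hlam : 0 < lam) (hb : 0 < b) (hp0 : 0 < p)
    (hp1 : p < 1) (hD : denom lam b p ≠ 0) : IsSolution lam b p 1 (gluedCdf lam b p q) := by
  have hev : ∀ n : ℕ, ∀ x ∈ Set.Ioo ((n : ℝ) * b) ((n + 1 : ℝ) * b),
      gluedCdf lam b p q =ᶠ[𝓝 x] pieceCdf lam b p q n := fun n x hx => by
    filter_upwards [isOpen_Ioo.mem_nhds hx] with y hy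
    exact gluedCdf_eq_of_mem_Ico hb ⟨hy.1.le, hy.2⟩
  refine ⟨continuousOn_Ici_of_Icc hb fun n => ?_, fun x hx => ?_, fun n x hx => ?_⟩
  · exact (continuousOn_pieceCdf q hlam hb hp0 hp1 n).congr fun x hx =>
      gluedCdf_eq hlam hb hp0 hp1 hD hx
  · have hx' : x ∈ Set.Ioo (((0 : ℕ) : ℝ) * b) (((0 : ℕ) + 1 : ℝ) * b) := by simpa using hx
    refine ((hasDerivAt_pieceCdf_zero lam b p q x hlam hp0 hp1).congr_of_eventuallyEq
      (hev 0 x hx')).congr_deriv ?_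
    rw [pieceCdf_zero_ode lam b p q x hlam hp0 hp1, gluedCdf_eq_of_mem_Ico (n := 0) hb
      ⟨hx'.1.le, hx'.2⟩, gluedCdf_eq_of_mem_Ico (n := 0) (x := b - x) hb
      ⟨by simp; linarith [hx.2], by simp; linarith [hx.1]⟩, one_mul]
  · have h1 := hx.1
    have h2 := hx.2
    push_cast at h1 h2
    have hn : (0 : ℝ) ≤ (n : ℝ) * b := by positivity
    refine ((hasDerivAt_pieceCdf lam b p q hlam hp0 hp1 n x (by linarith)
      (Or.inl (by linarith))).congr_of_eventuallyEq
      (hev (n + 1) x hx)).congr_deriv ?_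
    rw [gluedCdf_eq_of_mem_Ico (n := n + 1) hb ⟨hx.1.le, hx.2⟩,
      gluedCdf_eq_of_mem_Ico (n := n) (x := x - b) hb ⟨by linarith, by linarith⟩]
    ring

/-- The derivative of a solution exists off the multiples of `b`. -/
theorem IsSolution.hasDerivAt_deriv {lam b p c : ℝ} (hb : 0 < b) {F : ℝ → ℝ}
    (hF : IsSolution lam b p c F) {x : ℝ} (hx : 0 < x)
    (hxb : x ∉ Set.range fun n : ℕ => (n : ℝ) * b) : HasDerivAt F (deriv F x) x := by
  obtain ⟨n, hn⟩ := exists_mem_Icc_mul hb hx.le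
  have hlt : (n : ℝ) * b < x := lt_of_le_of_ne hn.1 fun h => hxb ⟨n, h⟩
  cases n with
  | zero => exact (hF.hasDerivAt_first x ⟨by simpa using hlt, by simpa using hn.2⟩)
      |>.differentiableAt.hasDerivAt
  | succ n => exact (hF.hasDerivAt_succ n x ⟨hlt, hn.2⟩).differentiableAt.hasDerivAt

/-- The possible kinks at the multiples of `b` are countable, so the fundamental theorem of calculus
survives them. -/
theorem IsSolution.integral_deriv {lam b p c : ℝ} (hb : 0 < b) {F : ℝ → ℝ}
    (hF : IsSolution lam b p c F) (hint : IntegrableOn (deriv F) (Set.Ioi 0)) {x : ℝ}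
    (hx : 0 ≤ x) : ∫ y in (0 : ℝ)..x, deriv F y = F x - F 0 := by
  refine integral_eq_of_hasDerivAt_off_countable_of_le F (deriv F) hx
    (Set.countable_range fun n : ℕ => (n : ℝ) * b)
    (hF.continuousOn.mono Set.Icc_subset_Ici_self)
    (fun y hy => hF.hasDerivAt_deriv hb hy.1.1 hy.2) ?_
  rw [intervalIntegrable_iff_integrableOn_Ioc_of_le hx]
  exact hint.mono_set Set.Ioc_subset_Ioi_self

/-- The normalisation equation determines `q`, given one bounded solution `F` that is nonnegative,
nondecreasing and tends to `1`. -/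
theorem isNormalised_iff {lam b p : ℝ} (hlam : 0 < lam) (hb : 0 < b) (hp0 : 0 < p)
    (hp1 : p < 1) (hD : denom lam b p ≠ 0) {F : ℝ → ℝ} (hF : IsSolution lam b p 1 F)
    (hF0 : ∀ x, 0 ≤ F x) (hF1 : ∀ x, F x ≤ 1) (hmono : Monotone F)
    (hlim : Tendsto F atTop (𝓝 1)) (hderiv : ∀ x ∈ Set.Ioi b, DifferentiableAt ℝ F x) (q : ℝ) :
    IsNormalised lam b p q ↔ q = F 0 := by
  constructor
  · rintro ⟨hint, -⟩
    have hG := isSolution_gluedCdf q hlam hb hp0 hp1 hD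
    -- Integrability of the derivative already bounds the glued function, and this alone forces `q =
    -- F 0`.
    have hbd : ∀ x, 0 ≤ x → |(gluedCdf lam b p q - F) x| ≤
        (∫ y in Set.Ioi (0 : ℝ), ‖deriv (gluedCdf lam b p q) y‖) + |q| + 1 := by
      intro x hx
      have h := hG.integral_deriv hb hint hx
      rw [gluedCdf_zero q hlam hb hp0 hp1 hD, intervalIntegral.integral_of_le hx] at h
      have h1 : |gluedCdf lam b p q x - q| ≤
          ∫ y in Set.Ioi (0 : ℝ), ‖deriv (gluedCdf lam b p q) y‖ := by
        rw [← h]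
        exact (norm_integral_le_integral_norm _).trans (setIntegral_mono_set hint.norm
          (Eventually.of_forall fun _ => norm_nonneg _) Set.Ioc_subset_Ioi_self.eventuallyLE)
      have h2 : |F x| ≤ 1 := by rw [abs_of_nonneg (hF0 x)]; exact hF1 x
      have e : (gluedCdf lam b p q - F) x = (gluedCdf lam b p q x - q) + q - F x := by
        simp
      rw [e]
      exact (abs_sub _ _).trans (add_le_add ((abs_add_le _ _).trans (add_le_add_left h1 _)) h2)
    have := (hG.sub hF).eq_zero_of_bounded hlam hb hp0 hp1 hbd le_rfl
    rw [Pi.sub_apply, gluedCdf_zero q hlam hb hp0 hp1 hD] at this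
    linarith
  · rintro rfl
    have hG := isSolution_gluedCdf (F 0) hlam hb hp0 hp1 hD
    have heq : ∀ x, 0 ≤ x → gluedCdf lam b p (F 0) x = F x := fun x hx =>
      sub_eq_zero.1 ((hG.sub hF).eq_zero hlam hb hp0 hp1 hD
        (by simp [gluedCdf_zero (F 0) hlam hb hp0 hp1 hD]) hx)
    have hder : Set.EqOn (deriv (gluedCdf lam b p (F 0))) (deriv F) (Set.Ioi 0) := fun x hx =>
      Filter.EventuallyEq.deriv_eq (by
        filter_upwards [Ioi_mem_nhds hx] with y hy using heq y (le_of_lt hy))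
    -- On `(0, b)` the equation gives a continuous representative up to the endpoints; beyond `b`
    -- the derivative is nonnegative and `F` has a finite limit.
    have hintF : IntegrableOn (deriv F) (Set.Ioi 0) := by
      have hc : ContinuousOn (fun x => lam * (F x - 1 * (1 - p) + (1 - p) * F (b - x)))
          (Set.Icc 0 b) := by
        have hcF : ContinuousOn F (Set.Icc 0 b) := hF.continuousOn.mono Set.Icc_subset_Ici_self
        refine continuousOn_const.mul ((hcF.sub continuousOn_const).add (continuousOn_const.mul
          (hcF.comp (by fun_prop) ?_)))
        intro y hy
        exact ⟨by linarith [hy.2], by linarith [hy.1]⟩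
      have h1 : IntegrableOn (deriv F) (Set.Ioo 0 b) :=
        (hc.integrableOn_Icc.mono_set Set.Ioo_subset_Icc_self).congr_fun
          (fun x hx => (hF.hasDerivAt_first x hx).deriv.symm) measurableSet_Ioo
      have h2 : IntegrableOn (deriv F) (Set.Ioi b) :=
        integrableOn_Ioi_deriv_of_nonneg ((hF.continuousOn b hb.le).mono
          (Set.Ici_subset_Ici.2 hb.le)) (fun x hx => (hderiv x hx).hasDerivAt)
          (fun x _ => hmono.deriv_nonneg) hlim
      rw [← Set.Ioc_union_Ioi_eq_Ioi hb.le, integrableOn_union,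
        integrableOn_Ioc_iff_integrableOn_Ioo]
      exact ⟨h1, h2⟩
    refine ⟨hintF.congr_fun hder.symm measurableSet_Ioi, ?_⟩
    rw [setIntegral_congr_fun measurableSet_Ioi hder]
    have ht := intervalIntegral_tendsto_integral_Ioi 0 hintF tendsto_id
    have ht' : Tendsto (fun x : ℝ => ∫ y in (0 : ℝ)..x, deriv F y) atTop (𝓝 (1 - F 0)) :=
      (hlim.sub_const (F 0)).congr' (by
        filter_upwards [eventually_ge_atTop 0] with x hx
        exact (hF.integral_deriv hb hintF hx).symm)
    rw [tendsto_nhds_unique ht ht']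
    ring

/-! ### The transition operator and its stationary measure -/

/-- One step of the recursion, as a function of the waiting time and the pair `(A, Y)`. -/
def step (b : ℝ) (z : ℝ × ℝ × ℝ) : ℝ := max 0 (b - z.2.1 + z.2.2 * |z.1|)

theorem measurable_step (b : ℝ) : Measurable (step b) := by
  unfold step; fun_prop

/-- The values of `(A, Y)` that reset the waiting time to `0`. -/
def resetSet (b : ℝ) : Set (ℝ × ℝ) := Set.Ioi b ×ˢ {-1}

theorem measurableSet_resetSet (b : ℝ) : MeasurableSet (resetSet b) :=
  measurableSet_Ioi.prod (measurableSet_singleton _)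

theorem step_eq_zero {b w : ℝ} {z : ℝ × ℝ} (hz : z ∈ resetSet b) : step b (w, z) = 0 := by
  have h1 : b < z.1 := hz.1
  have h2 : z.2 = -1 := hz.2
  refine max_eq_left ?_
  simp only [h2]
  linarith [abs_nonneg w]

/-- The law of the next waiting time, given the measures of the current one and of `(A, Y)`. -/
def push (b : ℝ) (ρ : Measure (ℝ × ℝ)) (μ : Measure ℝ) : Measure ℝ := (μ.prod ρ).map (step b)

theorem push_univ (b : ℝ) (ρ : Measure (ℝ × ℝ)) [SFinite ρ] (μ : Measure ℝ) :
    push b ρ μ Set.univ = μ Set.univ * ρ Set.univ := by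
  rw [push, Measure.map_apply (measurable_step b) MeasurableSet.univ, Set.preimage_univ,
    ← Set.univ_prod_univ, Measure.prod_prod]

theorem push_sum (b : ℝ) (ρ : Measure (ℝ × ℝ)) [SFinite ρ] {ι : Type*} (μ : ι → Measure ℝ) :
    push b ρ (Measure.sum μ) = Measure.sum fun i => push b ρ (μ i) := by
  simp only [push]
  rw [Measure.prod_sum_left, Measure.map_sum (measurable_step b).aemeasurable]

theorem push_smul (b : ℝ) (ρ : Measure (ℝ × ℝ)) [SFinite ρ] (c : ENNReal) (μ : Measure ℝ) :
    push b ρ (c • μ) = c • push b ρ μ := by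
  simp only [push]
  rw [Measure.prod_smul_left, Measure.map_smul]

/-- On the reset set `step` is constantly `0`, so that part of `ρ` contributes only an atom at `0`,
whatever `μ` looks like. -/
theorem push_split (b : ℝ) (ρ : Measure (ℝ × ℝ)) [SFinite ρ] (μ : Measure ℝ) [SFinite μ] :
    push b ρ μ = push b (ρ.restrict (resetSet b)ᶜ) μ
      + (μ Set.univ * ρ (resetSet b)) • Measure.dirac 0 := by
  have hR := measurableSet_resetSet b
  have h : (μ.prod (ρ.restrict (resetSet b))).map (step b)
      = (μ Set.univ * ρ (resetSet b)) • Measure.dirac 0 := by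
    have h0 : step b =ᵐ[μ.prod (ρ.restrict (resetSet b))] fun _ => 0 := by
      have hm : MeasurableSet {z | step b z = 0} :=
        measurable_step b (measurableSet_singleton 0)
      rw [Filter.EventuallyEq, ae_iff]
      change (μ.prod (ρ.restrict (resetSet b))) {z | step b z = 0}ᶜ = 0
      rw [Measure.prod_apply hm.compl]
      refine (lintegral_eq_zero_iff' (measurable_measure_prodMk_left hm.compl).aemeasurable).2
        (Eventually.of_forall fun w => ?_)
      have : Prod.mk w ⁻¹' {z | step b z = 0}ᶜ ⊆ (resetSet b)ᶜ := fun z hz hzR =>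
        hz (step_eq_zero hzR)
      exact measure_mono_null this (by simp [Measure.restrict_apply hR.compl])
    rw [Measure.map_congr h0, Measure.map_const, ← Set.univ_prod_univ, Measure.prod_prod,
      Measure.restrict_apply_univ]
  rw [← h, push, push, ← Measure.map_add _ _ (measurable_step b), ← Measure.prod_add,
    add_comm (ρ.restrict _), Measure.restrict_add_restrict_compl hR]

/-- The law after `k` steps without a reset, started from `0`. -/
def noReset (b : ℝ) (ρ : Measure (ℝ × ℝ)) (k : ℕ) : Measure ℝ :=
  (push b (ρ.restrict (resetSet b)ᶜ))^[k] (Measure.dirac 0)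

theorem noReset_univ (b : ℝ) (ρ : Measure (ℝ × ℝ)) [SFinite ρ] (k : ℕ) :
    noReset b ρ k Set.univ = ρ (resetSet b)ᶜ ^ k := by
  induction k with
  | zero => simp [noReset]
  | succ k ih =>
    rw [noReset, Function.iterate_succ_apply', ← noReset, push_univ, ih,
      Measure.restrict_apply_univ, pow_succ]

/-- The stationary waiting-time law, decomposed according to the time since the last reset. -/
def stationary (b : ℝ) (ρ : Measure (ℝ × ℝ)) : Measure ℝ :=
  ρ (resetSet b) • Measure.sum (noReset b ρ)

theorem isProbabilityMeasure_stationary (b : ℝ) (ρ : Measure (ℝ × ℝ)) [IsProbabilityMeasure ρ]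
    (hρ : ρ (resetSet b) ≠ 0) : IsProbabilityMeasure (stationary b ρ) := by
  constructor
  rw [stationary, Measure.smul_apply, Measure.sum_apply _ MeasurableSet.univ]
  simp only [noReset_univ, smul_eq_mul]
  rw [ENNReal.tsum_geometric, prob_compl_eq_one_sub (measurableSet_resetSet b),
    ENNReal.sub_sub_cancel ENNReal.one_ne_top prob_le_one]
  exact ENNReal.mul_inv_cancel hρ (measure_ne_top _ _)

/-- A step without reset moves the summand `k` to `k + 1`; the atom created by a reset supplies the
missing summand `k = 0`. -/
theorem push_stationary (b : ℝ) (ρ : Measure (ℝ × ℝ)) [IsProbabilityMeasure ρ]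
    (hρ : ρ (resetSet b) ≠ 0) : push b ρ (stationary b ρ) = stationary b ρ := by
  have := isProbabilityMeasure_stationary b ρ hρ
  rw [push_split, measure_univ, one_mul, stationary, push_smul, push_sum, ← smul_add]
  congr 1
  ext s hs
  rw [Measure.add_apply, Measure.sum_apply _ hs, Measure.sum_apply _ hs,
    tsum_eq_zero_add' (f := fun i => noReset b ρ i s) ENNReal.summable, add_comm]
  congr 1
  refine tsum_congr fun k => ?_
  rw [noReset, noReset, Function.iterate_succ_apply']

/-- Splits by the time of the last reset before `n`; the final term is the event that none occurred,
and its mass decays geometrically. -/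
theorem iterate_push_eq (b : ℝ) (ρ : Measure (ℝ × ℝ)) [IsProbabilityMeasure ρ] (n : ℕ) :
    (push b ρ)^[n] (Measure.dirac 0) =
      ρ (resetSet b) • Measure.sum (fun k : Fin n => noReset b ρ k) + noReset b ρ n := by
  have huniv : ∀ n, (push b ρ)^[n] (Measure.dirac 0) Set.univ = 1 := by
    intro n
    induction n with
    | zero => simp
    | succ n ih => rw [Function.iterate_succ_apply', push_univ, ih, measure_univ, one_mul]
  induction n with
  | zero => simp [noReset]
  | succ n ih =>
    have : IsFiniteMeasure ((push b ρ)^[n] (Measure.dirac 0)) := ⟨by simp [huniv]⟩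
    rw [Function.iterate_succ_apply', push_split, huniv, one_mul, ih]
    have hadd : ∀ μ μ' : Measure ℝ, push b (ρ.restrict (resetSet b)ᶜ) (μ + μ') =
        push b (ρ.restrict (resetSet b)ᶜ) μ + push b (ρ.restrict (resetSet b)ᶜ) μ' := by
      intro μ μ'
      have := push_sum b (ρ.restrict (resetSet b)ᶜ) (fun i : Bool => cond i μ μ')
      simpa [Measure.sum_bool] using this
    rw [hadd, push_smul, push_sum]
    ext s hs
    simp only [Measure.add_apply, Measure.smul_apply, Measure.sum_apply _ hs, smul_eq_mul,
      tsum_fintype, Fin.sum_univ_succ, mul_add]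
    simp only [noReset, Fin.val_zero, Function.iterate_zero_apply, Fin.val_succ,
      Function.iterate_succ_apply']
    ring

theorem tendsto_iterate_push (b : ℝ) (ρ : Measure (ℝ × ℝ)) [IsProbabilityMeasure ρ]
    (hρ : ρ (resetSet b) ≠ 0) {s : Set ℝ} (hs : MeasurableSet s) :
    Tendsto (fun n => (push b ρ)^[n] (Measure.dirac 0) s) atTop (𝓝 (stationary b ρ s)) := by
  have hlt : ρ (resetSet b)ᶜ < 1 := by
    rw [prob_compl_eq_one_sub (measurableSet_resetSet b)]
    exact ENNReal.sub_lt_self ENNReal.one_ne_top one_ne_zero hρ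
  have h1 : Tendsto (fun n => noReset b ρ n s) atTop (𝓝 0) :=
    tendsto_of_tendsto_of_tendsto_of_le_of_le tendsto_const_nhds
      (ENNReal.tendsto_pow_atTop_nhds_zero_of_lt_one hlt) (fun _ => zero_le)
      fun n => (measure_mono (Set.subset_univ s)).trans (noReset_univ b ρ n).le
  have h2 : Tendsto (fun n => ∑ k ∈ Finset.range n, noReset b ρ k s) atTop
      (𝓝 (∑' k, noReset b ρ k s)) := ENNReal.tendsto_nat_tsum _
  have h3 := (ENNReal.Tendsto.const_mul (a := ρ (resetSet b)) h2
    (Or.inr (measure_ne_top _ _))).add h1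
  rw [stationary, Measure.smul_apply, Measure.sum_apply _ hs, smul_eq_mul]
  rw [add_zero] at h3
  refine h3.congr fun n => ?_
  rw [iterate_push_eq, Measure.add_apply, Measure.smul_apply, Measure.sum_apply _ hs, smul_eq_mul,
    tsum_fintype, Fin.sum_univ_eq_sum_range (fun k => noReset b ρ k s)]

/-! ### The waiting times -/

theorem waitingTime_nonneg {Ω : Type*} {W₀ : Ω → ℝ} {A B Y : ℕ → Ω → ℝ} (h0 : ∀ ω, 0 ≤ W₀ ω)
    (n : ℕ) (ω : Ω) : 0 ≤ waitingTime W₀ A B Y n ω := by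
  cases n with
  | zero => exact h0 ω
  | succ n => exact le_max_left _ _

theorem waitingTime_succ {Ω : Type*} {W₀ : Ω → ℝ} {A Y : ℕ → Ω → ℝ} {b : ℝ}
    (h0 : ∀ ω, 0 ≤ W₀ ω) (n : ℕ) (ω : Ω) :
    waitingTime W₀ A (fun _ _ => b) Y (n + 1) ω =
      step b (waitingTime W₀ A (fun _ _ => b) Y n ω, (A n ω, Y n ω)) := by
  simp only [step, waitingTime]
  rw [abs_of_nonneg (waitingTime_nonneg h0 n ω)]

theorem measurable_waitingTime {Ω : Type*} [MeasurableSpace Ω] {W₀ : Ω → ℝ} {A Y : ℕ → Ω → ℝ}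
    {b : ℝ} (hW₀ : Measurable W₀) (n : ℕ) (hA : ∀ k < n, Measurable (A k))
    (hY : ∀ k < n, Measurable (Y k)) : Measurable (waitingTime W₀ A (fun _ _ => b) Y n) := by
  induction n with
  | zero => exact hW₀
  | succ n ih =>
    have h := ih (fun k hk => hA k (by omega)) (fun k hk => hY k (by omega))
    exact measurable_const.max ((measurable_const.sub (hA n (by omega))).add
      ((hY n (by omega)).mul h))

theorem map_waitingTime {Ω : Type*} [MeasurableSpace Ω] {P : Measure Ω} [IsProbabilityMeasure P]
    {A Y : ℕ → Ω → ℝ} {b : ℝ} {ρ : Measure (ℝ × ℝ)} (hA : ∀ n, Measurable (A n))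
    (hY : ∀ n, Measurable (Y n)) (hρ : ∀ n, P.map (fun ω => (A n ω, Y n ω)) = ρ)
    (hind : iIndepFun (fun n ω => (A n ω, Y n ω)) P) (n : ℕ) :
    P.map (waitingTime (fun _ => 0) A (fun _ _ => b) Y n) =
      (push b ρ)^[n] (Measure.dirac 0) := by
  have hm : ∀ n, Measurable (waitingTime (fun _ => 0) A (fun _ _ => b) Y n) := fun n =>
    measurable_waitingTime measurable_const n (fun k _ => hA k) (fun k _ => hY k)
  induction n with
  | zero => simp [waitingTime]
  | succ n ih =>
    have hAY : ∀ n, Measurable fun ω => (A n ω, Y n ω) := fun n => (hA n).prodMk (hY n)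
    -- `W_n` is realised as a measurable function of the first `n` pairs, to make it independent of
    -- the pair `n`. The value `0` assigned to indices from `n` on is never read.
    have hmeas : Measurable (waitingTime (fun _ : Finset.range n → ℝ × ℝ => 0)
        (fun k g => if h : k ∈ Finset.range n then (g ⟨k, h⟩).1 else 0) (fun _ _ => b)
        (fun k g => if h : k ∈ Finset.range n then (g ⟨k, h⟩).2 else 0) n) := by
      refine measurable_waitingTime measurable_const n (fun k hk => ?_) (fun k hk => ?_)
      · simp only [Finset.mem_range, hk, dite_true]; fun_prop
      · simp only [Finset.mem_range, hk, dite_true]; fun_prop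
    have hcomp : ∀ m ≤ n, ∀ ω, waitingTime (fun _ => 0) A (fun _ _ => b) Y m ω =
        waitingTime (fun _ : Finset.range n → ℝ × ℝ => 0)
        (fun k g => if h : k ∈ Finset.range n then (g ⟨k, h⟩).1 else 0) (fun _ _ => b)
        (fun k g => if h : k ∈ Finset.range n then (g ⟨k, h⟩).2 else 0) m
        (fun i => (A i ω, Y i ω)) := by
      intro m hm ω
      induction m with
      | zero => rfl
      | succ m ihm =>
        have hmn : m < n := hm
        simp only [waitingTime]
        rw [ihm hmn.le]
        simp [hmn]
    have hI : IndepFun (waitingTime (fun _ => 0) A (fun _ _ => b) Y n)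
        (fun ω => (A n ω, Y n ω)) P := by
      have h := (hind.indepFun_finset (Finset.range n) {n} (by simp) hAY).comp hmeas
        (measurable_pi_apply (⟨n, Finset.mem_singleton_self n⟩ : ({n} : Finset ℕ)))
      have e : waitingTime (fun _ => 0) A (fun _ _ => b) Y n = _ := funext (hcomp n le_rfl)
      rw [e]
      exact h
    have hprod := (indepFun_iff_map_prod_eq_prod_map_map (hm n).aemeasurable
      (hAY n).aemeasurable).1 hI
    have hsucc : waitingTime (fun _ => 0) A (fun _ _ => b) Y (n + 1) =
        step b ∘ fun ω => (waitingTime (fun _ => 0) A (fun _ _ => b) Y n ω, (A n ω, Y n ω)) :=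
      funext fun ω => waitingTime_succ (fun _ => le_rfl) n ω
    rw [hsucc, ← Measure.map_map (measurable_step b) ((hm n).prodMk (hAY n)), hprod, hρ, ih,
      Function.iterate_succ_apply', ← push]

/-- Waiting times with different initial values coincide from the first reset on. -/
theorem measure_waitingTime_ne_le {Ω : Type*} [MeasurableSpace Ω] {P : Measure Ω}
    {W₀ : Ω → ℝ} {A Y : ℕ → Ω → ℝ} {b : ℝ} {ρ : Measure (ℝ × ℝ)} (h0 : ∀ ω, 0 ≤ W₀ ω)
    (hA : ∀ n, Measurable (A n)) (hY : ∀ n, Measurable (Y n))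
    (hρ : ∀ n, P.map (fun ω => (A n ω, Y n ω)) = ρ)
    (hind : iIndepFun (fun n ω => (A n ω, Y n ω)) P) (n : ℕ) :
    P {ω | waitingTime W₀ A (fun _ _ => b) Y n ω ≠
      waitingTime (fun _ => 0) A (fun _ _ => b) Y n ω} ≤ ρ (resetSet b)ᶜ ^ n := by
  have hsub : {ω | waitingTime W₀ A (fun _ _ => b) Y n ω ≠
      waitingTime (fun _ => 0) A (fun _ _ => b) Y n ω} ⊆
      ⋂ k ∈ Finset.range n, (fun ω => (A k ω, Y k ω)) ⁻¹' (resetSet b)ᶜ := by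
    intro ω hω
    contrapose! hω
    simp only [Set.mem_iInter, not_forall, Set.mem_preimage, Set.mem_compl_iff, not_not,
      Finset.mem_range, exists_prop] at hω
    rw [Set.mem_ofPred_eq, not_not]
    induction n with
    | zero => obtain ⟨k, hk, -⟩ := hω; omega
    | succ n ih =>
      rw [waitingTime_succ h0, waitingTime_succ fun _ => le_rfl]
      obtain ⟨k, hk, hkR⟩ := hω
      rcases Nat.lt_succ_iff_lt_or_eq.1 hk with h | rfl
      · rw [ih ⟨k, h, hkR⟩]
      · rw [step_eq_zero hkR, step_eq_zero hkR]
  refine (measure_mono hsub).trans ?_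
  have hR := (measurableSet_resetSet b).compl
  rw [hind.meas_biInter fun k _ => ⟨_, hR, rfl⟩]
  have : ∀ k ∈ Finset.range n, P ((fun ω => (A k ω, Y k ω)) ⁻¹' (resetSet b)ᶜ) =
      ρ (resetSet b)ᶜ := fun k _ => by
    rw [← Measure.map_apply ((hA k).prodMk (hY k)) hR, hρ]
  rw [Finset.prod_congr rfl this, Finset.prod_const, Finset.card_range]

theorem tendstoInDistribution_waitingTime {Ω : Type*} [MeasurableSpace Ω] {P : Measure Ω}
    [IsProbabilityMeasure P] {W₀ : Ω → ℝ} {A Y : ℕ → Ω → ℝ} {b : ℝ} {ρ : Measure (ℝ × ℝ)}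
    [IsProbabilityMeasure ρ] (hρ0 : ρ (resetSet b) ≠ 0) (ν : ProbabilityMeasure ℝ)
    (hν : (ν : Measure ℝ) = stationary b ρ)
    (hW₀ : Measurable W₀) (h0 : ∀ ω, 0 ≤ W₀ ω)
    (hA : ∀ n, Measurable (A n)) (hY : ∀ n, Measurable (Y n))
    (hρ : ∀ n, P.map (fun ω => (A n ω, Y n ω)) = ρ)
    (hind : iIndepFun (fun n ω => (A n ω, Y n ω)) P) :
    TendstoInDistribution (waitingTime W₀ A (fun _ _ => b) Y) atTop
        (id : ℝ → ℝ) (fun _ => P) (ν : Measure ℝ) := by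
  have hm : ∀ n, Measurable (waitingTime W₀ A (fun _ _ => b) Y n) := fun n =>
    measurable_waitingTime hW₀ n (fun k _ => hA k) (fun k _ => hY k)
  have hm0 : ∀ n, Measurable (waitingTime (fun _ => 0) A (fun _ _ => b) Y n) := fun n =>
    measurable_waitingTime measurable_const n (fun k _ => hA k) (fun k _ => hY k)
  refine ⟨fun n => (hm n).aemeasurable, aemeasurable_id, ?_⟩
  -- Portmanteau with open sets: the law started from `W₀` gives `G` at least the mass it has when
  -- started from `0`, minus the probability of no reset so far.
  refine tendsto_of_forall_isOpen_le_liminf_nat' fun G hG => ?_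
  have hGm := hG.measurableSet
  simp only [ProbabilityMeasure.coe_mk, Measure.map_id]
  have hlt : ρ (resetSet b)ᶜ < 1 := by
    rw [prob_compl_eq_one_sub (measurableSet_resetSet b)]
    exact ENNReal.sub_lt_self ENNReal.one_ne_top one_ne_zero hρ0
  have ht := ENNReal.Tendsto.sub (tendsto_iterate_push b ρ hρ0 hGm)
    (ENNReal.tendsto_pow_atTop_nhds_zero_of_lt_one hlt) (Or.inr ENNReal.zero_ne_top)
  rw [tsub_zero] at ht
  rw [hν, ← ht.liminf_eq]
  refine liminf_le_liminf (Eventually.of_forall fun n => ?_)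
  rw [tsub_le_iff_right, ← map_waitingTime hA hY hρ hind n, Measure.map_apply (hm0 n) hGm,
    Measure.map_apply (hm n) hGm]
  refine le_trans ?_ (add_le_add_right (measure_waitingTime_ne_le h0 hA hY hρ hind n) _)
  refine (measure_mono fun ω hω => ?_).trans (measure_union_le _ _)
  by_cases h : waitingTime W₀ A (fun _ _ => b) Y n ω =
    waitingTime (fun _ => 0) A (fun _ _ => b) Y n ω
  · exact Or.inl (by rw [Set.mem_preimage, h]; exact hω)
  · exact Or.inr h

/-! ### The law of the pairs `(A, Y)` -/

/-- The law of `Y`. -/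
def signMeasure (p : ℝ) : Measure ℝ :=
  ENNReal.ofReal p • Measure.dirac 1 + ENNReal.ofReal (1 - p) • Measure.dirac (-1)

/-- The law of `(A, Y)`. -/
def driving (lam p : ℝ) : Measure (ℝ × ℝ) := (expMeasure lam).prod (signMeasure p)

theorem isProbabilityMeasure_signMeasure {p : ℝ} (hp0 : 0 < p) (hp1 : p < 1) :
    IsProbabilityMeasure (signMeasure p) := by
  constructor
  simp only [signMeasure, Measure.add_apply, Measure.smul_apply, measure_univ, smul_eq_mul, mul_one]
  rw [← ENNReal.ofReal_add hp0.le (by linarith)]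
  simp

theorem map_eq_signMeasure {Ω : Type*} [MeasurableSpace Ω] {P : Measure Ω} [IsProbabilityMeasure P]
    {p : ℝ} (hp0 : 0 < p) (hp1 : p < 1) {Y : Ω → ℝ} (hY : Measurable Y)
    (h1 : P.real {ω | Y ω = 1} = p) (h2 : P.real {ω | Y ω = -1} = 1 - p) :
    P.map Y = signMeasure p := by
  have := Measure.isProbabilityMeasure_map (μ := P) hY.aemeasurable
  have := isProbabilityMeasure_signMeasure hp0 hp1
  have e1 : P.map Y {1} = ENNReal.ofReal p := by
    rw [Measure.map_apply hY (measurableSet_singleton _), ← h1, ofReal_measureReal]; rfl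
  have e2 : P.map Y {-1} = ENNReal.ofReal (1 - p) := by
    rw [Measure.map_apply hY (measurableSet_singleton _), ← h2, ofReal_measureReal]; rfl
  -- The two atoms give an inequality of measures; equality follows since both have total mass one.
  have hr : signMeasure p = (P.map Y).restrict ({1} ∪ {-1}) := by
    rw [Measure.restrict_union (by norm_num) (measurableSet_singleton _),
      Measure.restrict_singleton, Measure.restrict_singleton, e1, e2, signMeasure]
  refine (Measure.eq_of_le_of_measure_univ_eq ?_ ?_).symm
  · rw [hr]; exact Measure.restrict_le_self
  · rw [measure_univ, measure_univ]

theorem nullSingletonClass_expMeasure (lam : ℝ) : NullSingletonClass (expMeasure lam) :=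
  ⟨fun x => withDensity_absolutelyContinuous _ _ (measure_singleton x)⟩

theorem expMeasure_Ici {lam : ℝ} (hlam : 0 < lam) (t : ℝ) :
    expMeasure lam (Set.Ici t) = ENNReal.ofReal (Real.exp (-lam * max t 0)) := by
  have := isProbabilityMeasure_expMeasure hlam
  have := nullSingletonClass_expMeasure lam
  have h := cdf_expMeasure_eq hlam t
  rw [cdf_eq_real] at h
  have h2 : (expMeasure lam).real (Set.Ici t) = Real.exp (-lam * max t 0) := by
    rw [← Set.compl_Iio, probReal_compl_eq_one_sub measurableSet_Iio,
      measureReal_congr Iio_ae_eq_Iic, h]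
    split_ifs with ht
    · rw [max_eq_left ht]; ring_nf
    · rw [max_eq_right (not_le.1 ht).le]; simp
  rw [← h2, ofReal_measureReal]

theorem isProbabilityMeasure_driving {lam p : ℝ} (hlam : 0 < lam) (hp0 : 0 < p) (hp1 : p < 1) :
    IsProbabilityMeasure (driving lam p) := by
  have := isProbabilityMeasure_expMeasure hlam
  have := isProbabilityMeasure_signMeasure hp0 hp1
  unfold driving
  infer_instance

theorem driving_resetSet_ne_zero {lam b p : ℝ} (hlam : 0 < lam) (hp0 : 0 < p) (hp1 : p < 1) :
    driving lam p (resetSet b) ≠ 0 := by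
  have := isProbabilityMeasure_expMeasure hlam
  have := isProbabilityMeasure_signMeasure hp0 hp1
  have := nullSingletonClass_expMeasure lam
  rw [driving, resetSet, Measure.prod_prod, measure_congr Ioi_ae_eq_Ici, expMeasure_Ici hlam]
  refine mul_ne_zero (by simp [Real.exp_pos]) ?_
  have : (1 : ℝ) ∉ ({-1} : Set ℝ) := by norm_num
  simp [signMeasure, this, hp1]

/-! ### The distribution function of the stationary law -/

/-- The survival function of the exponential distribution. -/
def expTail (lam t : ℝ) : ℝ := Real.exp (-lam * max t 0)

theorem expTail_mem (lam t : ℝ) (hlam : 0 < lam) : expTail lam t ∈ Set.Icc 0 1 :=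
  ⟨(Real.exp_pos _).le, Real.exp_le_one_iff.2 (by nlinarith [le_max_right t 0])⟩

theorem lipschitzWith_expTail {lam : ℝ} (hlam : 0 < lam) :
    LipschitzWith (Real.toNNReal lam) (expTail lam) := by
  have key : ∀ u v : ℝ, 0 ≤ u → u ≤ v → |Real.exp (-lam * u) - Real.exp (-lam * v)| ≤
      lam * (v - u) := by
    intro u v hu huv
    have e : Real.exp (-lam * v) = Real.exp (-lam * u) * Real.exp (-(lam * (v - u))) := by
      rw [← Real.exp_add]; ring_nf
    have h1 := Real.add_one_le_exp (-(lam * (v - u)))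
    have h2 : Real.exp (-lam * u) ≤ 1 := Real.exp_le_one_iff.2 (by nlinarith)
    have h3 := Real.exp_pos (-lam * u)
    have h4 : Real.exp (-(lam * (v - u))) ≤ 1 := Real.exp_le_one_iff.2 (by nlinarith)
    rw [e, abs_of_nonneg (by nlinarith)]
    nlinarith
  refine LipschitzWith.of_dist_le_mul fun s t => ?_
  rw [Real.coe_toNNReal _ hlam.le, Real.dist_eq, Real.dist_eq]
  have hmax : |max s 0 - max t 0| ≤ |s - t| := abs_max_sub_max_le_abs s t 0
  refine le_trans ?_ (mul_le_mul_of_nonneg_left hmax hlam.le)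
  unfold expTail
  rcases le_total (max s 0) (max t 0) with h | h
  · rw [abs_sub_comm (max s 0), abs_of_nonneg (sub_nonneg.2 h)]
    exact key _ _ (le_max_right _ _) h
  · rw [abs_sub_comm (Real.exp _), abs_of_nonneg (sub_nonneg.2 h)]
    exact key _ _ (le_max_right _ _) h

/-- The derivative is expressed through the function itself and an indicator, so that
differentiating the stationarity integral returns the distribution function and masses of
half-lines. -/
theorem hasDerivAt_expTail (lam : ℝ) {t : ℝ} (ht : t ≠ 0) :
    HasDerivAt (expTail lam) (-lam * (expTail lam t - if t ≤ 0 then 1 else 0)) t := by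
  rcases lt_or_gt_of_ne ht with h | h
  · have e : expTail lam =ᶠ[𝓝 t] fun _ => 1 := by
      filter_upwards [Iio_mem_nhds h] with y hy
      have hy : y < 0 := hy
      simp [expTail, hy.le]
    rw [e.eq_of_nhds, if_pos h.le, sub_self, mul_zero]
    exact (hasDerivAt_const t 1).congr_of_eventuallyEq e
  · have e : expTail lam =ᶠ[𝓝 t] fun y => Real.exp (-lam * y) := by
      filter_upwards [Ioi_mem_nhds h] with y hy
      have hy : 0 < y := hy
      simp [expTail, hy.le]
    rw [e.eq_of_nhds, if_neg (not_le.2 h), sub_zero]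
    refine HasDerivAt.congr_of_eventuallyEq ?_ e
    simpa [mul_comm] using ((hasDerivAt_id t).const_mul (-lam)).exp

/-- The probability that the waiting time after `w` is at most `x`. -/
def transCdf (lam b p x w : ℝ) : ℝ :=
  p * expTail lam (b - x + w) + (1 - p) * expTail lam (b - x - w)

theorem transCdf_mem {lam b p x w : ℝ} (hlam : 0 < lam) (hp0 : 0 < p) (hp1 : p < 1) :
    transCdf lam b p x w ∈ Set.Icc 0 1 := by
  have h1 := expTail_mem lam (b - x + w) hlam
  have h2 := expTail_mem lam (b - x - w) hlam
  have h3 : 0 < 1 - p := by linarith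
  refine ⟨add_nonneg (mul_nonneg hp0.le h1.1) (mul_nonneg h3.le h2.1), ?_⟩
  have h4 := mul_le_mul_of_nonneg_left h1.2 hp0.le
  have h5 := mul_le_mul_of_nonneg_left h2.2 h3.le
  unfold transCdf
  linarith

theorem lipschitzWith_transCdf {lam b p : ℝ} (hlam : 0 < lam) (hp0 : 0 < p) (hp1 : p < 1) (w : ℝ) :
    LipschitzWith (Real.toNNReal lam) fun x => transCdf lam b p x w := by
  refine LipschitzWith.of_dist_le_mul fun x y => ?_
  have h1 := (lipschitzWith_expTail hlam).dist_le_mul (b - x + w) (b - y + w)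
  have h2 := (lipschitzWith_expTail hlam).dist_le_mul (b - x - w) (b - y - w)
  rw [Real.coe_toNNReal _ hlam.le, Real.dist_eq, Real.dist_eq] at *
  have e1 : |b - x + w - (b - y + w)| = |x - y| := by rw [← abs_neg]; ring_nf
  have e2 : |b - x - w - (b - y - w)| = |x - y| := by rw [← abs_neg]; ring_nf
  rw [e1] at h1
  rw [e2] at h2
  have e : transCdf lam b p x w - transCdf lam b p y w =
      p * (expTail lam (b - x + w) - expTail lam (b - y + w)) +
      (1 - p) * (expTail lam (b - x - w) - expTail lam (b - y - w)) := by
    unfold transCdf; ring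
  rw [e]
  refine (abs_add_le _ _).trans ?_
  rw [abs_mul, abs_mul, abs_of_pos hp0, abs_of_pos (sub_pos.2 hp1)]
  have h4 := mul_le_mul_of_nonneg_left h1 hp0.le
  have h5 := mul_le_mul_of_nonneg_left h2 (sub_pos.2 hp1).le
  linarith

theorem measurable_transCdf (lam b p x : ℝ) : Measurable (transCdf lam b p x) := by
  unfold transCdf expTail; fun_prop

theorem integrable_transCdf {lam b p x : ℝ} (hlam : 0 < lam) (hp0 : 0 < p) (hp1 : p < 1)
    (ν : Measure ℝ) [IsProbabilityMeasure ν] : Integrable (transCdf lam b p x) ν :=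
  Integrable.of_bound (measurable_transCdf lam b p x).aestronglyMeasurable 1
    (Eventually.of_forall fun w => by
      have h := transCdf_mem (b := b) (x := x) (w := w) hlam hp0 hp1
      rw [Real.norm_eq_abs, abs_of_nonneg h.1]; exact h.2)

theorem hasDerivAt_transCdf {lam b p x w : ℝ} (h1 : w ≠ x - b) (h2 : w ≠ b - x) :
    HasDerivAt (fun x => transCdf lam b p x w)
      (lam * (transCdf lam b p x w - p * (Set.Iic (x - b)).indicator 1 w
        - (1 - p) * (Set.Ici (b - x)).indicator 1 w)) x := by
  have n1 : b - x + w ≠ 0 := fun h => h1 (by linarith)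
  have n2 : b - x - w ≠ 0 := fun h => h2 (by linarith)
  have d1 := (hasDerivAt_expTail lam n1).comp x
    (((hasDerivAt_id x).const_sub b).add_const w)
  have d2 := (hasDerivAt_expTail lam n2).comp x
    (((hasDerivAt_id x).const_sub b).sub_const w)
  refine ((d1.const_mul p).add (d2.const_mul (1 - p))).congr_deriv ?_
  have e1 : (Set.Iic (x - b)).indicator (1 : ℝ → ℝ) w = if b - x + w ≤ 0 then 1 else 0 := by
    have : w ≤ x - b ↔ b - x + w ≤ 0 := by constructor <;> intro h <;> linarith
    simp only [Set.indicator_apply, Set.mem_Iic, this, Pi.one_apply]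
  have e2 : (Set.Ici (b - x)).indicator (1 : ℝ → ℝ) w = if b - x - w ≤ 0 then 1 else 0 := by
    have : b - x ≤ w ↔ b - x - w ≤ 0 := by constructor <;> intro h <;> linarith
    simp only [Set.indicator_apply, Set.mem_Ici, this, Pi.one_apply]
  rw [e1, e2, transCdf]
  ring

/-- A stationary law is concentrated on `[0, ∞)`. -/
theorem measure_Iio_zero_of_push_eq {b : ℝ} {ρ : Measure (ℝ × ℝ)} {ν : Measure ℝ}
    (hν : push b ρ ν = ν) : ν (Set.Iio 0) = 0 := by
  rw [← hν, push, Measure.map_apply (measurable_step b) measurableSet_Iio]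
  have : step b ⁻¹' Set.Iio 0 = ∅ := by
    ext z; simp [step]
  rw [this, measure_empty]

section Stationary

variable {lam b p : ℝ} {ν : Measure ℝ} [IsProbabilityMeasure ν]

/-- Evaluates stationarity on `(-∞, x]`: given `w` and `Y = y`, the next waiting time is at most `x`
exactly when `A ≥ b - x + y |w|`. The absolute value in `step` disappears because the law lives on
`[0, ∞)`. -/
theorem cdf_eq_integral (hlam : 0 < lam) (hp0 : 0 < p) (hp1 : p < 1)
    (hν : push b (driving lam p) ν = ν) {x : ℝ} (hx : 0 ≤ x) :
    cdf ν x = ∫ w, transCdf lam b p x w ∂ν := by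
  have := isProbabilityMeasure_expMeasure hlam
  have := isProbabilityMeasure_signMeasure hp0 hp1
  have := isProbabilityMeasure_driving hlam hp0 hp1
  have hS : MeasurableSet (step b ⁻¹' Set.Iic x) := measurable_step b measurableSet_Iic
  have hsec : ∀ w, driving lam p (Prod.mk w ⁻¹' (step b ⁻¹' Set.Iic x)) =
      ENNReal.ofReal (transCdf lam b p x |w|) := by
    intro w
    have hT : MeasurableSet (Prod.mk w ⁻¹' (step b ⁻¹' Set.Iic x)) := measurable_prodMk_left hS
    have hy : ∀ y, (fun a => (a, y)) ⁻¹' (Prod.mk w ⁻¹' (step b ⁻¹' Set.Iic x)) =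
        Set.Ici (b - x + y * |w|) := by
      intro y
      ext a
      simp only [Set.mem_preimage, Set.mem_Iic, Set.mem_Ici, step, max_le_iff, hx, true_and]
      constructor <;> intro h <;> linarith
    rw [driving, Measure.prod_apply_symm hT]
    simp only [hy, expMeasure_Ici hlam]
    rw [signMeasure, lintegral_add_measure, lintegral_smul_measure, lintegral_smul_measure,
      lintegral_dirac, lintegral_dirac, smul_eq_mul, smul_eq_mul, ← ENNReal.ofReal_mul hp0.le,
      ← ENNReal.ofReal_mul (by linarith), ← ENNReal.ofReal_add
        (mul_nonneg hp0.le (Real.exp_pos _).le) (mul_nonneg (by linarith) (Real.exp_pos _).le)]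
    simp only [transCdf, expTail, one_mul, neg_mul, ← sub_eq_add_neg]
  have hae : ∀ᵐ w ∂ν, 0 ≤ w := by
    rw [ae_iff]
    simp only [not_le]
    exact measure_Iio_zero_of_push_eq hν
  rw [cdf_eq_real, integral_eq_lintegral_of_nonneg_ae
    (Eventually.of_forall fun w => (transCdf_mem hlam hp0 hp1).1)
    (measurable_transCdf lam b p x).aestronglyMeasurable, measureReal_def]
  congr 1
  conv_lhs => rw [← hν]
  rw [push, Measure.map_apply (measurable_step b) measurableSet_Iic, Measure.prod_apply hS]
  refine lintegral_congr_ae ?_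
  filter_upwards [hae] with w hw
  rw [hsec, abs_of_nonneg hw]

theorem lipschitzOnWith_cdf (hlam : 0 < lam) (hp0 : 0 < p) (hp1 : p < 1)
    (hν : push b (driving lam p) ν = ν) :
    LipschitzOnWith (Real.toNNReal lam) (cdf ν) (Set.Ici 0) := by
  refine LipschitzOnWith.of_dist_le_mul fun x hx y hy => ?_
  rw [cdf_eq_integral hlam hp0 hp1 hν hx, cdf_eq_integral hlam hp0 hp1 hν hy, dist_eq_norm,
    ← integral_sub (integrable_transCdf hlam hp0 hp1 ν) (integrable_transCdf hlam hp0 hp1 ν)]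
  refine (norm_integral_le_of_norm_le_const (Eventually.of_forall fun w => ?_)).trans
    (by rw [probReal_univ, mul_one])
  rw [← dist_eq_norm]
  exact (lipschitzWith_transCdf hlam hp0 hp1 w).dist_le_mul x y

/-- The kernel is Lipschitz in `x`, hence so is the distribution function on `[0, ∞)`; only the
point `0` can carry an atom. -/
theorem measure_singleton_eq_zero (hlam : 0 < lam) (hp0 : 0 < p) (hp1 : p < 1)
    (hν : push b (driving lam p) ν = ν) {y : ℝ} (hy : y ≠ 0) : ν {y} = 0 := by
  rcases lt_or_gt_of_ne hy with h | h
  · exact measure_mono_null (by simpa using h) (measure_Iio_zero_of_push_eq hν)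
  · have hc : ContinuousAt (cdf ν) y :=
      (lipschitzOnWith_cdf hlam hp0 hp1 hν).continuousOn.continuousAt (Ici_mem_nhds h)
    rw [← measure_cdf ν, StieltjesFunction.measure_singleton,
      leftLim_eq_of_tendsto (hc.tendsto.mono_left nhdsWithin_le_nhds)]
    simp

theorem hasDerivAt_cdf (hlam : 0 < lam) (hp0 : 0 < p) (hp1 : p < 1)
    (hν : push b (driving lam p) ν = ν) {x : ℝ} (hx : 0 < x) (hxb : x ≠ b) :
    HasDerivAt (cdf ν) (lam * (cdf ν x - p * ν.real (Set.Iic (x - b))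
      - (1 - p) * ν.real (Set.Ici (b - x)))) x := by
  have hK := integrable_transCdf (b := b) (x := x) hlam hp0 hp1 ν
  have i1 : Integrable ((Set.Iic (x - b)).indicator (1 : ℝ → ℝ)) ν :=
    (integrable_const (1 : ℝ)).indicator measurableSet_Iic
  have i2 : Integrable ((Set.Ici (b - x)).indicator (1 : ℝ → ℝ)) ν :=
    (integrable_const (1 : ℝ)).indicator measurableSet_Ici
  have h := (hasDerivAt_integral_of_dominated_loc_of_lip (μ := ν) (𝕜 := ℝ)
    (F := fun x w => transCdf lam b p x w) (x₀ := x) (s := Set.univ) (bound := fun _ => lam)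
    (F' := fun w => lam * (transCdf lam b p x w - p * (Set.Iic (x - b)).indicator 1 w
        - (1 - p) * (Set.Ici (b - x)).indicator 1 w)) univ_mem
    (Eventually.of_forall fun y => (measurable_transCdf lam b p y).aestronglyMeasurable)
    hK
    (((hK.sub (i1.const_mul p)).sub (i2.const_mul (1 - p))).const_mul lam).aestronglyMeasurable
    (Eventually.of_forall fun w => by
      have := lipschitzWith_transCdf (b := b) hlam hp0 hp1 w
      have e : Real.nnabs lam = Real.toNNReal lam := Real.nnabs_of_nonneg hlam.le
      rw [e]
      exact this.lipschitzOnWith)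
    (integrable_const lam)
    (by
      -- The kernel fails to be differentiable only when `w` is `x - b` or `b - x`. As `x ≠ b`,
      -- neither is `0`, so neither is an atom.
      have a1 : ∀ᵐ w ∂ν, w ≠ x - b := by
        rw [ae_iff]
        simpa using measure_singleton_eq_zero hlam hp0 hp1 hν (sub_ne_zero.2 hxb)
      have a2 : ∀ᵐ w ∂ν, w ≠ b - x := by
        rw [ae_iff]
        simpa using measure_singleton_eq_zero hlam hp0 hp1 hν (sub_ne_zero.2 hxb.symm)
      filter_upwards [a1, a2] with w h1 h2 using hasDerivAt_transCdf h1 h2)).2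
  refine (h.congr_of_eventuallyEq ?_).congr_deriv ?_
  · filter_upwards [Ioi_mem_nhds hx] with y hy
    exact cdf_eq_integral hlam hp0 hp1 hν (le_of_lt hy)
  · have e : ∀ s : Set ℝ, MeasurableSet s → ∫ w, s.indicator (1 : ℝ → ℝ) w ∂ν = ν.real s :=
      fun s hs => integral_indicator_one hs
    have h1 : Integrable (fun w => transCdf lam b p x w - p * (Set.Iic (x - b)).indicator 1 w) ν :=
      hK.sub (i1.const_mul p)
    rw [integral_const_mul, integral_sub h1 (i2.const_mul (1 - p)),
      integral_sub hK (i1.const_mul p), integral_const_mul, integral_const_mul,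
      e _ measurableSet_Iic, e _ measurableSet_Ici, cdf_eq_integral hlam hp0 hp1 hν hx.le]

theorem hasDerivAt_cdf_of_gt (hlam : 0 < lam) (hb : 0 < b) (hp0 : 0 < p) (hp1 : p < 1)
    (hν : push b (driving lam p) ν = ν) {x : ℝ} (hx : b < x) :
    HasDerivAt (cdf ν) (lam * (cdf ν x - 1 + p - p * cdf ν (x - b))) x := by
  refine (hasDerivAt_cdf hlam hp0 hp1 hν (hb.trans hx) hx.ne').congr_deriv ?_
  have h : ν.real (Set.Ici (b - x)) = 1 := by
    rw [← Set.compl_Iio, probReal_compl_eq_one_sub measurableSet_Iio, measureReal_def,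
      measure_mono_null (Set.Iio_subset_Iio (by linarith)) (measure_Iio_zero_of_push_eq hν)]
    simp
  rw [h, cdf_eq_real ν (x - b)]
  ring

theorem isSolution_cdf (hlam : 0 < lam) (hb : 0 < b) (hp0 : 0 < p) (hp1 : p < 1)
    (hν : push b (driving lam p) ν = ν) : IsSolution lam b p 1 (cdf ν) := by
  refine ⟨(lipschitzOnWith_cdf hlam hp0 hp1 hν).continuousOn, fun x hx => ?_, fun n x hx => ?_⟩
  · refine (hasDerivAt_cdf hlam hp0 hp1 hν hx.1 hx.2.ne).congr_deriv ?_
    have h1 : ν.real (Set.Iic (x - b)) = 0 := by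
      rw [measureReal_def, measure_mono_null (Set.Iic_subset_Iio.2 (by linarith [hx.2]))
        (measure_Iio_zero_of_push_eq hν)]
      simp
    have h2 : ν.real (Set.Ici (b - x)) = 1 - cdf ν (b - x) := by
      have hy : b - x ≠ 0 := by linarith [hx.2]
      rw [← Set.compl_Iio, probReal_compl_eq_one_sub measurableSet_Iio, cdf_eq_real,
        measureReal_congr (Iio_ae_eq_Iic' (measure_singleton_eq_zero hlam hp0 hp1 hν hy))]
    rw [h1, h2]
    ring
  · have h1 := hx.1
    have hn : (0 : ℝ) ≤ (n : ℝ) * b := by positivity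
    push_cast at h1
    refine (hasDerivAt_cdf_of_gt hlam hb hp0 hp1 hν (by linarith)).congr_deriv ?_
    ring

theorem cdf_zero_eq (hν : push b (driving lam p) ν = ν) : cdf ν 0 = ν.real {0} := by
  rw [cdf_eq_real, ← Set.Iio_union_right, measureReal_def, measureReal_def]
  congr 1
  refine le_antisymm ((measure_union_le _ _).trans ?_) (measure_mono Set.subset_union_right)
  rw [measure_Iio_zero_of_push_eq hν, zero_add]

end Stationary

end LindleyMD

end

theorem theorem3 {Ω : Type*} [MeasurableSpace Ω] (P : Measure Ω) [IsProbabilityMeasure P]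
    (lam b p : ℝ) (hlam : 0 < lam) (hb : 0 < b) (hp0 : 0 < p) (hp1 : p < 1)
    (hdenom : LindleyMD.denom lam b p ≠ 0)
    (W₀ : Ω → ℝ) (A Y : ℕ → Ω → ℝ)
    (hW₀ : Measurable W₀) (hW₀_nonneg : ∀ ω, 0 ≤ W₀ ω)
    (hA : ∀ n, Measurable (A n)) (hY : ∀ n, Measurable (Y n))
    (hA_law : ∀ n, P.map (A n) = expMeasure lam)
    (hY_pos : ∀ n, P.real {ω | Y n ω = 1} = p)
    (hY_neg : ∀ n, P.real {ω | Y n ω = -1} = 1 - p)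
    (hindep_time : iIndepFun (fun n ω => (A n ω, Y n ω)) P)
    (hindep_AY : ∀ n, IndepFun (A n) (Y n) P) :
    ∃ ν : ProbabilityMeasure ℝ,
      TendstoInDistribution (LindleyMD.waitingTime W₀ A (fun _ _ => b) Y) atTop
        (id : ℝ → ℝ) (fun _ => P) (ν : Measure ℝ) ∧
      (∀ i : ℕ, ∀ x ∈ Set.Icc ((i : ℝ) * b) (((i : ℝ) + 1) * b),
        cdf (ν : Measure ℝ) x
          = LindleyMD.pieceCdf lam b p ((ν : Measure ℝ).real {0}) i x) ∧
      (∀ x ∈ Set.Ioo 0 b,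
        HasDerivAt (fun y => cdf (ν : Measure ℝ) y)
          (∑ j : Fin 2, LindleyMD.coeff lam b p ((ν : Measure ℝ).real {0}) j
            * Real.exp (LindleyMD.rate lam p j * x)) x) ∧
      (∀ x ∈ Set.Ioi b,
        HasDerivAt (fun y => cdf (ν : Measure ℝ) y)
          (lam * (cdf (ν : Measure ℝ) x - 1 + p - p * cdf (ν : Measure ℝ) (x - b))) x) ∧
      (∀ q : ℝ, LindleyMD.IsNormalised lam b p q ↔ q = (ν : Measure ℝ).real {0}) := by
  have hρ := LindleyMD.isProbabilityMeasure_driving hlam hp0 hp1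
  have hρ0 := LindleyMD.driving_resetSet_ne_zero (b := b) hlam hp0 hp1
  have hlaw : ∀ n, P.map (fun ω => (A n ω, Y n ω)) = LindleyMD.driving lam p := fun n => by
    rw [(indepFun_iff_map_prod_eq_prod_map_map (hA n).aemeasurable (hY n).aemeasurable).1
      (hindep_AY n), hA_law, LindleyMD.map_eq_signMeasure hp0 hp1 (hY n) (hY_pos n) (hY_neg n),
      LindleyMD.driving]
  have hprob := LindleyMD.isProbabilityMeasure_stationary b (LindleyMD.driving lam p) hρ0
  have hstat := LindleyMD.push_stationary b (LindleyMD.driving lam p) hρ0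
  have hsol := LindleyMD.isSolution_cdf hlam hb hp0 hp1 hstat
  have hzero := LindleyMD.cdf_zero_eq hstat
  -- Both functions solve the delay equation and take the same value at `0`, so their difference is
  -- a homogeneous solution that vanishes.
  have heq : ∀ x, 0 ≤ x → cdf (LindleyMD.stationary b (LindleyMD.driving lam p)) x =
      LindleyMD.gluedCdf lam b p (cdf (LindleyMD.stationary b (LindleyMD.driving lam p)) 0) x :=
    fun x hx => sub_eq_zero.1 ((hsol.sub (LindleyMD.isSolution_gluedCdf _ hlam hb hp0 hp1
      hdenom)).eq_zero hlam hb hp0 hp1 hdenom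
        (by simp [LindleyMD.gluedCdf_zero _ hlam hb hp0 hp1 hdenom]) hx)
  refine ⟨⟨LindleyMD.stationary b (LindleyMD.driving lam p), hprob⟩,
    LindleyMD.tendstoInDistribution_waitingTime hρ0 _ rfl hW₀ hW₀_nonneg hA hY hlaw hindep_time,
    ?_, ?_, ?_, ?_⟩ <;>
    simp only [ProbabilityMeasure.coe_mk, ← hzero]
  · intro i x hx
    have hx0 : 0 ≤ x := le_trans (by positivity) hx.1
    rw [heq x hx0, LindleyMD.gluedCdf_eq hlam hb hp0 hp1 hdenom hx]
  · intro x hx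
    refine (LindleyMD.hasDerivAt_pieceCdf_zero lam b p _ x hlam hp0 hp1).congr_of_eventuallyEq ?_
    filter_upwards [isOpen_Ioo.mem_nhds hx] with y hy
    rw [heq y hy.1.le, LindleyMD.gluedCdf_eq_of_mem_Ico (n := 0) hb
      ⟨by simpa using hy.1.le, by simpa using hy.2⟩]
  · exact fun x hx => LindleyMD.hasDerivAt_cdf_of_gt hlam hb hp0 hp1 hstat hx
  · exact LindleyMD.isNormalised_iff hlam hb hp0 hp1 hdenom hsol (cdf_nonneg _) (cdf_le_one _)
      (monotone_cdf _) (tendsto_cdf_atTop _) fun x hx =>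
        (LindleyMD.hasDerivAt_cdf_of_gt hlam hb hp0 hp1 hstat hx).differentiableAt
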